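/- For a finite simple graph $G$, let $\lambda(G)$ be its spectral radius, i.e. the largest eigenvalue of its adjacency matrix, and let the independence number of $G$ be the largest size of a set of pairwise non-adjacent vertices. For $n,\alpha\ge 1$ let $\mathcal{G}_{n,\alpha}$ be the set of all connected simple graphs with $n$ vertices and independence number $\alpha$. For integers $k\ge 2$ and $\alpha\ge 1$, let the clique path $P_{k\alpha,\alpha}$ be the graph consisting of $\alpha$ disjoint cliques $K_k$, say on vertex sets $V_1,\dots,V_\alpha$, together with exactly one edge between $V_i$ and $V_{i+1}$ for each $1\le i\le\alpha-1$, where these $\alpha-1$ edges are pairwise disjoint (so that $P_{k\alpha,\alpha}$ has exactly $2\alpha-2$ cut vertices); it is unique up to isomorphism. **Theorem.** Let $\alpha\ge 1$ and $k$ be integers with $k>\frac{17\alpha+15}{8}$, and let $n=k\alpha$. Then $P_{n,\alpha}\in\mathcal{G}_{n,\alpha}$, and $P_{n,\alpha}$ is the only graph (up to isomorphism) having the minimum spectral radius in $\mathcal{G}_{n,\alpha}$. In other words, for every $G\in\mathcal{G}_{n,\alpha}$, $$\lambda(G)\ge\lambda(P_{n,\alpha}),$$ with equality if and only if $G$ is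 isomorphic to $P_{n,\alpha}$. -/

import Mathlib

/-- The spectral radius `λ(G)` of a finite graph: the largest eigenvalue of its `(0,1)` adjacency
matrix. (The spectrum of a real square matrix is the finite set of its real eigenvalues; for a
graph with at least one vertex it is nonempty because the adjacency matrix is symmetric, so the
supremum is a maximum.) -/
noncomputable def graphSpectralRadius {V : Type*} [Fintype V] (G : SimpleGraph V) : ℝ :=
  open Classical in sSup (spectrum ℝ (G.adjMatrix ℝ))

/-- Membership in the family of connected graphs of order `n` with independence number `α`. -/
structure IsConnectedOfOrderIndep (n α : ℕ) {V : Type*} [Fintype V] (G : SimpleGraph V) :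
    Prop where
  order_eq : Fintype.card V = n
  connected : G.Connected
  indepNum_eq : G.indepNum = α

/-- The clique path `P_{kα,α}`: the vertices `(i, 0), …, (i, k - 1)` form the `i`-th clique `K_k`
(for `i = 0, …, α - 1`), and the only other edges are the `α - 1` edges joining the last vertex
`(i, k - 1)` of the `i`-th clique to the first vertex `(i + 1, 0)` of the next one. For `k ≥ 2` the
edges entering and leaving a clique are attached at different vertices. -/
def cliquePath (k α : ℕ) : SimpleGraph (Fin α × Fin k) :=
  SimpleGraph.fromRel fun p q =>
    p.1 = q.1 ∨ (p.1.val + 1 = q.1.val ∧ p.2.val + 1 = k ∧ q.2.val = 0)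

open Finset

/-! Let λ be the spectral radius of the clique path, L = λ + 1, and let G satisfy λ(G) ≤ λ. It
suffices to show that G is the clique path. Since λ ≤ k - 1 + 2/(k - 1)
(`cliquePath_spectralRadius_le`), G has so few edges that a stability form of Turán's theorem
(`exists_clique_partition`) splits it into α cliques; none can exceed order k, so all have order k.

G is then compared with the path by a test vector. Summing the Perron vector of the clique path over
its cliques gives weights on a path with α vertices that are symmetric and increase towards the
centre (`pathEigenvector_lt`). Listed in decreasing order as z, they make the clique of rank j in
the path hang on that of rank j - 2. Contracting the cliques of G gives a connected graph, which
`exists_zigzag_order` ranks so that the clique of rank j has an edge to one of rank p j ≤ j - 2;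
hence z (p j) ≥ z (j - 2).

Extend z to a vector y on G by the formula that holds for the Perron vector of the path
(`cliqueLift`), and let W be its clique sums. Pointwise A y - λ y ≥ W - z, so y·(A - λ)y ≥ Σ W (W -
z) = Σ (W - z)² + Σ z (W - z). The last sum is a positive multiple of the excess of the edge forms
of the tree over those of the path, and is nonnegative because the parents in G weigh at least as
much. So λ(G) ≥ λ, and equality forces p j = j - 2, disjoint links and no further edges
(`spectralRadius_comparison`). -/

/-- The sum of `y` over the neighbours of `v`, i.e. the `v`-entry of the adjacency matrix times
`y`. -/
noncomputable def SimpleGraph.adjSum {V : Type*} [Fintype V] (G : SimpleGraph V) (y : V → ℝ)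
    (v : V) : ℝ :=
  open Classical in ∑ w, if G.Adj v w then y w else 0

/-! ### Rayleigh quotients and Perron vectors. -/

section SpectralRadius

variable {V : Type*} [Fintype V] (G : SimpleGraph V)

open Classical in
theorem SimpleGraph.adjMatrix_mulVec_eq_adjSum (y : V → ℝ) :
    (G.adjMatrix ℝ).mulVec y = G.adjSum y := by
  ext v
  simp [SimpleGraph.adjSum, Matrix.mulVec, dotProduct, SimpleGraph.adjMatrix_apply]

open Classical in
theorem graphSpectralRadius_mem_spectrum [Nonempty V] :
    graphSpectralRadius G ∈ spectrum ℝ (G.adjMatrix ℝ) ∧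
      ∀ μ ∈ spectrum ℝ (G.adjMatrix ℝ), μ ≤ graphSpectralRadius G := by
  have hfin : (spectrum ℝ (G.adjMatrix ℝ)).Finite := Matrix.finite_real_spectrum
  have hne : (spectrum ℝ (G.adjMatrix ℝ)).Nonempty := by
    rw [(G.isHermitian_adjMatrix ℝ).spectrum_real_eq_range_eigenvalues]
    exact Set.range_nonempty _
  exact ⟨hne.csSup_mem hfin, fun μ hμ => le_csSup hfin.bddAbove hμ⟩

open Classical in
theorem posSemidef_spectralRadius_sub [Nonempty V] :
    (algebraMap ℝ (Matrix V V ℝ) (graphSpectralRadius G) - G.adjMatrix ℝ).PosSemidef := by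
  rw [Matrix.posSemidef_iff_isHermitian_and_spectrum_nonneg]
  constructor
  · refine Matrix.IsHermitian.sub ?_ (G.isHermitian_adjMatrix ℝ)
    rw [Algebra.algebraMap_eq_smul_one]
    simp [Matrix.IsHermitian]
  · rw [← spectrum.singleton_sub_eq]
    rintro _ ⟨r, hr, μ, hμ, rfl⟩
    rw [Set.mem_singleton_iff] at hr
    subst hr
    simpa using (graphSpectralRadius_mem_spectrum G).2 μ hμ

open Classical in
theorem spectralRadius_sub_mulVec (y : V → ℝ) :
    (algebraMap ℝ (Matrix V V ℝ) (graphSpectralRadius G) - G.adjMatrix ℝ).mulVec y =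
      fun v => graphSpectralRadius G * y v - G.adjSum y v := by
  rw [Matrix.sub_mulVec, SimpleGraph.adjMatrix_mulVec_eq_adjSum, Algebra.algebraMap_eq_smul_one,
    Matrix.smul_mulVec, Matrix.one_mulVec]
  rfl

theorem sum_mul_adjSum_le [Nonempty V] (y : V → ℝ) :
    ∑ v, y v * G.adjSum y v ≤ graphSpectralRadius G * ∑ v, y v ^ 2 := by
  classical
  have h := (posSemidef_spectralRadius_sub G).dotProduct_mulVec_nonneg y
  rw [spectralRadius_sub_mulVec] at h
  simp only [dotProduct, star_trivial, mul_sub, Finset.sum_sub_distrib] at h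
  rw [Finset.mul_sum]
  have : ∀ v, graphSpectralRadius G * y v ^ 2 = y v * (graphSpectralRadius G * y v) :=
    fun v => by ring
  simp only [this]
  linarith

/-- The matrix λ(G) - A is positive semidefinite, and a vector on which its quadratic form vanishes
lies in its kernel. -/
theorem adjSum_eq_of_le [Nonempty V] (y : V → ℝ)
    (h : graphSpectralRadius G * ∑ v, y v ^ 2 ≤ ∑ v, y v * G.adjSum y v) (v : V) :
    G.adjSum y v = graphSpectralRadius G * y v := by
  classical
  have h0 := ((posSemidef_spectralRadius_sub G).dotProduct_mulVec_zero_iff y).1 (by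
    rw [spectralRadius_sub_mulVec]
    simp only [dotProduct, star_trivial, mul_sub, Finset.sum_sub_distrib]
    have h1 := sum_mul_adjSum_le G y
    have : ∀ v, y v * (graphSpectralRadius G * y v) = graphSpectralRadius G * y v ^ 2 :=
      fun v => by ring
    simp only [this, ← Finset.mul_sum]
    linarith)
  rw [spectralRadius_sub_mulVec] at h0
  have := congrFun h0 v
  simp at this
  linarith

theorem exists_nonneg_eigenvector [Nonempty V] :
    ∃ x : V → ℝ, (∀ v, 0 ≤ x v) ∧ (∃ v, x v ≠ 0) ∧
      ∀ v, G.adjSum x v = graphSpectralRadius G * x v := by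
  classical
  have h := (graphSpectralRadius_mem_spectrum G).1
  rw [← Matrix.spectrum_toLin', ← Module.End.hasEigenvalue_iff_mem_spectrum] at h
  obtain ⟨y, hy⟩ := h.exists_hasEigenvector
  have hy1 : G.adjSum y = graphSpectralRadius G • y := by
    have := hy.apply_eq_smul
    rwa [Matrix.toLin'_apply, SimpleGraph.adjMatrix_mulVec_eq_adjSum] at this
  have hy2 : ∃ v, y v ≠ 0 := by
    by_contra! hc
    exact hy.2 (funext hc)
  -- Passing to absolute values cannot decrease the quadratic form of A and keeps the norm, so the
  -- Rayleigh quotient is still maximal.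
  refine ⟨fun v => |y v|, fun v => abs_nonneg _, by simpa using hy2, fun v => ?_⟩
  apply adjSum_eq_of_le
  rw [Finset.mul_sum]
  refine Finset.sum_le_sum fun v _ => ?_
  have h1 : graphSpectralRadius G * |y v| ^ 2 = y v * G.adjSum y v := by
    rw [hy1, sq_abs]; simp; ring
  rw [h1]
  refine (le_abs_self _).trans ?_
  rw [abs_mul]
  refine mul_le_mul_of_nonneg_left ?_ (abs_nonneg _)
  unfold SimpleGraph.adjSum
  refine (Finset.abs_sum_le_sum_abs _ _).trans (Finset.sum_le_sum fun w _ => ?_)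
  split_ifs <;> simp

theorem le_adjSum {y : V → ℝ} (hy : ∀ v, 0 ≤ y v) {v w : V} (h : G.Adj v w) :
    y w ≤ G.adjSum y v := by
  classical
  unfold SimpleGraph.adjSum
  refine le_trans (by simp [h]) (Finset.single_le_sum (fun u _ => ?_) (Finset.mem_univ w))
  split_ifs <;> simp [hy]

/-- A zero entry forces zeros at all neighbours, hence everywhere along a walk. -/
theorem pos_of_adjSum_eq (hG : G.Connected) {x : V → ℝ} {μ : ℝ} (hx : ∀ v, 0 ≤ x v)
    (hx0 : ∃ v, x v ≠ 0) (h : ∀ v, G.adjSum x v = μ * x v) (v : V) : 0 < x v := by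
  obtain ⟨u, hu⟩ := hx0
  obtain ⟨p⟩ := hG.preconnected u v
  induction p with
  | nil => exact lt_of_le_of_ne (hx _) hu.symm
  | @cons a b c hab _ ih =>
    refine ih fun hb => ?_
    have h1 := le_adjSum G hx hab.symm
    rw [h b, hb, mul_zero] at h1
    exact hu (le_antisymm h1 (hx _))

theorem exists_pos_eigenvector (hG : G.Connected) :
    ∃ x : V → ℝ, (∀ v, 0 < x v) ∧ ∀ v, G.adjSum x v = graphSpectralRadius G * x v := by
  have := hG.nonempty
  obtain ⟨x, h1, h2, h3⟩ := exists_nonneg_eigenvector G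
  exact ⟨x, pos_of_adjSum_eq G hG h1 h2 h3, h3⟩

theorem sum_mul_adjSum_comm (x y : V → ℝ) :
    ∑ v, x v * G.adjSum y v = ∑ v, y v * G.adjSum x v := by
  classical
  simp only [SimpleGraph.adjSum, Finset.mul_sum]
  rw [Finset.sum_comm]
  refine Finset.sum_congr rfl fun v _ => Finset.sum_congr rfl fun w _ => ?_
  rw [G.adj_comm]
  split_ifs <;> ring

/-- Collatz–Wielandt bound: pair the inequality with a nonnegative eigenvector for the spectral
radius and use the symmetry of A. -/
theorem spectralRadius_le_of_adjSum_le [Nonempty V] {x : V → ℝ} {μ : ℝ} (hx : ∀ v, 0 < x v)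
    (h : ∀ v, G.adjSum x v ≤ μ * x v) : graphSpectralRadius G ≤ μ := by
  obtain ⟨z, h1, ⟨u, hu⟩, h3⟩ := exists_nonneg_eigenvector G
  have hpos : 0 < ∑ v, x v * z v :=
    Finset.sum_pos' (fun v _ => mul_nonneg (hx v).le (h1 v))
      ⟨u, Finset.mem_univ _, mul_pos (hx u) (lt_of_le_of_ne (h1 u) hu.symm)⟩
  have h4 := sum_mul_adjSum_comm G x z
  have h5 : ∑ v, x v * G.adjSum z v = graphSpectralRadius G * ∑ v, x v * z v := by
    rw [Finset.mul_sum]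
    exact Finset.sum_congr rfl fun v _ => by rw [h3]; ring
  have h6 : ∑ v, z v * G.adjSum x v ≤ μ * ∑ v, x v * z v := by
    rw [Finset.mul_sum]
    refine Finset.sum_le_sum fun v _ => ?_
    have := mul_le_mul_of_nonneg_left (h v) (h1 v)
    linarith
  rw [← h4, h5] at h6
  exact le_of_mul_le_mul_right h6 hpos

theorem card_sub_one_le_spectralRadius {s : Finset V} (hs : s.Nonempty)
    (h : ∀ u ∈ s, ∀ v ∈ s, u ≠ v → G.Adj u v) : (s.card : ℝ) - 1 ≤ graphSpectralRadius G := by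
  classical
  have : Nonempty V := ⟨hs.choose⟩
  have h1 := sum_mul_adjSum_le G (fun v => if v ∈ s then 1 else 0)
  have h2 : ∀ v ∈ s, (s.card : ℝ) - 1 ≤ G.adjSum (fun v => if v ∈ s then 1 else 0) v := by
    intro v hv
    have h3 : ((s.erase v).card : ℝ) = s.card - 1 := by
      rw [Finset.card_erase_of_mem hv, Nat.cast_sub (Finset.card_pos.2 hs)]; simp
    rw [← h3, SimpleGraph.adjSum, Finset.card_eq_sum_ones, Nat.cast_sum,
      ← Finset.sum_filter]
    refine le_trans ?_ (Finset.sum_le_sum_of_subset_of_nonneg (s := s.erase v) ?_ ?_)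
    · exact Finset.sum_le_sum fun w hw => by simp [Finset.mem_of_mem_erase hw]
    · intro w hw
      have := Finset.mem_erase.1 hw
      simpa using h v hv w this.2 this.1.symm
    · intro w _ _; split_ifs <;> simp
  have h3 : (s.card : ℝ) * (s.card - 1) ≤
      ∑ v, (if v ∈ s then (1 : ℝ) else 0) * G.adjSum (fun v => if v ∈ s then 1 else 0) v := by
    simp only [ite_mul, one_mul, zero_mul, Finset.sum_ite_mem, Finset.univ_inter]
    rw [← nsmul_eq_mul]
    exact Finset.card_nsmul_le_sum _ _ _ h2
  have h4 : ∑ v, (if v ∈ s then (1 : ℝ) else 0) ^ 2 = s.card := by simp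
  rw [h4] at h1
  have h5 : (0 : ℝ) < s.card := by exact_mod_cast Finset.card_pos.2 hs
  nlinarith

theorem adjSum_iso {W : Type*} [Fintype W] {H : SimpleGraph W} (e : G ≃g H) (y : W → ℝ) (v : V) :
    G.adjSum (fun u => y (e u)) v = H.adjSum y (e v) := by
  classical
  unfold SimpleGraph.adjSum
  refine Fintype.sum_equiv e.toEquiv _ _ fun w => ?_
  simp [e.map_adj_iff]

theorem spectralRadius_iso_le {W : Type*} [Fintype W] {H : SimpleGraph W} (e : G ≃g H) :
    graphSpectralRadius G ≤ graphSpectralRadius H := by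
  classical
  cases isEmpty_or_nonempty V with
  | inl hV =>
    have : IsEmpty W := e.toEquiv.symm.isEmpty
    simp [graphSpectralRadius]
  | inr hV =>
    have : Nonempty W := e.toEquiv.symm.nonempty
    obtain ⟨x, h1, ⟨u, hu⟩, h3⟩ := exists_nonneg_eigenvector G
    have h := sum_mul_adjSum_le H (fun w => x (e.symm w))
    have hpos : 0 < ∑ v, x v ^ 2 :=
      Finset.sum_pos' (fun v _ => sq_nonneg _) ⟨u, Finset.mem_univ _, by positivity⟩
    have h4 : ∑ w, x (e.symm w) ^ 2 = ∑ v, x v ^ 2 :=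
      Fintype.sum_equiv e.symm.toEquiv _ _ fun w => rfl
    have h5 : ∑ w, x (e.symm w) * H.adjSum (fun w => x (e.symm w)) w =
        ∑ v, x v * G.adjSum x v := by
      refine Fintype.sum_equiv e.symm.toEquiv _ _ fun w => ?_
      rw [adjSum_iso H e.symm x w]; rfl
    rw [h4, h5] at h
    simp only [h3] at h
    have h6 : ∑ v, x v * (graphSpectralRadius G * x v) = graphSpectralRadius G * ∑ v, x v ^ 2 := by
      rw [Finset.mul_sum]; exact Finset.sum_congr rfl fun v _ => by ring
    rw [h6] at h
    exact le_of_mul_le_mul_right h hpos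

theorem spectralRadius_eq_of_iso {W : Type*} [Fintype W] {H : SimpleGraph W} (e : G ≃g H) :
    graphSpectralRadius G = graphSpectralRadius H :=
  le_antisymm (spectralRadius_iso_le G e) (spectralRadius_iso_le H e.symm)

end SpectralRadius

/-! ### Stability in Turán's theorem. -/

section AdjPairs

variable {V : Type*} (G : SimpleGraph V)

/-- The number of ordered pairs of adjacent vertices in `S ×ˢ T`. -/
noncomputable def adjPairs (S T : Finset V) : ℤ :=
  open Classical in ∑ u ∈ S, ∑ w ∈ T, if G.Adj u w then 1 else 0

theorem adjPairs_comm (S T : Finset V) : adjPairs G S T = adjPairs G T S := by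
  classical
  unfold adjPairs
  rw [Finset.sum_comm]
  simp only [G.adj_comm]

theorem adjPairs_nonneg (S T : Finset V) : 0 ≤ adjPairs G S T := by
  classical
  unfold adjPairs
  exact Finset.sum_nonneg fun u _ => Finset.sum_nonneg fun w _ => by split_ifs <;> simp

open Classical in
theorem adjPairs_sdiff_right (S : Finset V) {T T' : Finset V} (h : T' ⊆ T) :
    adjPairs G S T = adjPairs G S T' + adjPairs G S (T \ T') := by
  unfold adjPairs
  rw [← Finset.sum_add_distrib]
  refine Finset.sum_congr rfl fun u _ => ?_
  rw [add_comm, Finset.sum_sdiff h]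

open Classical in
theorem adjPairs_sdiff_self {W S : Finset V} (h : S ⊆ W) :
    adjPairs G W W = adjPairs G S S + 2 * adjPairs G S (W \ S) +
      adjPairs G (W \ S) (W \ S) := by
  rw [adjPairs_sdiff_right G W h, adjPairs_comm G W S, adjPairs_comm G W (W \ S),
    adjPairs_sdiff_right G S h, adjPairs_sdiff_right G (W \ S) h, adjPairs_comm G (W \ S) S]
  ring

theorem card_mul_le_adjPairs {S T : Finset V} {d : ℤ}
    (h : ∀ u ∈ S, d ≤ adjPairs G {u} T) : (S.card : ℤ) * d ≤ adjPairs G S T := by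
  classical
  unfold adjPairs at *
  rw [← nsmul_eq_mul]
  refine Finset.card_nsmul_le_sum _ _ _ fun u hu => ?_
  simpa using h u hu

theorem adjPairs_self_le (S : Finset V) : adjPairs G S S ≤ S.card * (S.card - 1) := by
  classical
  unfold adjPairs
  rw [← nsmul_eq_mul]
  refine Finset.sum_le_card_nsmul _ _ _ fun u hu => ?_
  rw [← Finset.sum_erase_add _ _ hu]
  have h : ((S.erase u).card : ℤ) = S.card - 1 := by
    rw [Finset.card_erase_of_mem hu, Nat.cast_sub (Finset.card_pos.2 ⟨u, hu⟩)]; simp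
  rw [← h]
  simp only [SimpleGraph.irrefl, if_false, add_zero]
  rw [Finset.card_eq_sum_ones, Nat.cast_sum]
  exact Finset.sum_le_sum fun w _ => by split_ifs <;> simp

open Classical in
/-- A vertex set that is split into `a` cliques by `f` spans the edges of these cliques. -/
theorem sum_clique_le_adjPairs {W : Finset V} {a : ℕ} {f : V → ℕ} (hf : ∀ v ∈ W, f v < a)
    (hadj : ∀ u ∈ W, ∀ v ∈ W, u ≠ v → f u = f v → G.Adj u v) :
    ∑ i ∈ Finset.range a, ((#{v ∈ W | f v = i} : ℤ) * (#{v ∈ W | f v = i} - 1)) ≤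
      adjPairs G W W := by
  unfold adjPairs
  rw [← Finset.sum_fiberwise_of_maps_to (s := W) (t := Finset.range a) (g := f)
    (fun v hv => Finset.mem_range.2 (hf v hv))]
  refine Finset.sum_le_sum fun i _ => ?_
  rw [← nsmul_eq_mul]
  refine Finset.card_nsmul_le_sum _ _ _ fun u hu => ?_
  have hu' := Finset.mem_filter.1 hu
  have h : ((Finset.erase {v ∈ W | f v = i} u).card : ℤ) = #{v ∈ W | f v = i} - 1 := by
    rw [Finset.card_erase_of_mem hu, Nat.cast_sub (Finset.card_pos.2 ⟨u, hu⟩)]; simp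
  rw [← h, Finset.card_eq_sum_ones, Nat.cast_sum]
  refine le_trans ?_ (Finset.sum_le_sum_of_subset_of_nonneg
    (s := Finset.erase {v ∈ W | f v = i} u) ?_ ?_)
  · refine Finset.sum_le_sum fun w hw => ?_
    have h1 := Finset.mem_erase.1 hw
    have h2 := Finset.mem_filter.1 h1.2
    rw [if_pos (hadj u hu'.1 w h2.1 h1.1.symm (by rw [hu'.2, h2.2]))]
    simp
  · exact (Finset.erase_subset _ _).trans (Finset.filter_subset _ _)
  · intro w _ _; split_ifs <;> simp

/-- The linear part is the chord of n(n - 1) through k and k + 1. The remainder is nonnegative at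
integers (`mul_sub_one_nonneg`), so the pairs inside cliques are bounded below by a function of
their total order and number alone. -/
theorem mul_sub_one_eq (k n : ℤ) :
    n * (n - 1) = k * (k - 1) + 2 * k * (n - k) + (n - k) * (n - k - 1) := by ring

theorem mul_sub_one_nonneg (d : ℤ) : 0 ≤ d * (d - 1) := by
  rcases le_or_gt d 0 with h | h
  · exact mul_nonneg_of_nonpos_of_nonpos h (by omega)
  · exact mul_nonneg h.le (by omega)

open Classical in
/-- If a vertex set that is split into `a` cliques by `f` spans few edges, then every one of the
cliques has a vertex without neighbours outside of the clique. -/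
theorem exists_isolated_from_compl {k C : ℤ} (hC : C < k) {a : ℕ} {W N : Finset V}
    (hN : N ⊆ W) {f : V → ℕ} (hf : ∀ v ∈ W \ N, f v < a)
    (hadj : ∀ u ∈ W \ N, ∀ v ∈ W \ N, u ≠ v → f u = f v → G.Adj u v)
    (hdeg : (#N : ℤ) * (#N - 1) ≤ adjPairs G N W)
    (hE : adjPairs G W W ≤ (a + 1) * (k * (k - 1)) + 2 * k * (#W - k * (a + 1)) + C)
    {i : ℕ} (hi : i < a) :
    ∃ w ∈ W \ N, f w = i ∧ ∀ x ∈ W, ¬ (x ∈ W \ N ∧ f x = i) → ¬ G.Adj w x := by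
  by_contra! hcon
  set W' := W \ N with hW'
  set Q := {v ∈ W' | f v = i} with hQ
  have hQW' : Q ⊆ W' := Finset.filter_subset _ _
  have hW'W : W' ⊆ W := Finset.sdiff_subset
  have hQW : Q ⊆ W := hQW'.trans hW'W
  have hQcl : (#Q : ℤ) * (#Q - 1) ≤ adjPairs G Q Q := by
    have := sum_clique_le_adjPairs G (W := Q) (a := a) (f := f)
      (fun v hv => hf v (hQW' hv)) (fun u hu v hv => hadj u (hQW' hu) v (hQW' hv))
    refine le_trans ?_ this
    have h0 : ∀ j ∈ Finset.range a,
        0 ≤ ((#{v ∈ Q | f v = j} : ℤ) * (#{v ∈ Q | f v = j} - 1)) :=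
      fun j _ => mul_sub_one_nonneg _
    refine le_trans (le_of_eq ?_) (Finset.single_le_sum h0 (Finset.mem_range.2 hi))
    have : {v ∈ Q | f v = i} = Q := Finset.filter_true_of_mem fun v hv =>
      (Finset.mem_filter.1 hv).2
    rw [this]
  have hQout : (#Q : ℤ) * 1 ≤ adjPairs G Q (W \ Q) := by
    refine card_mul_le_adjPairs G fun w hw => ?_
    have hw' := Finset.mem_filter.1 hw
    obtain ⟨x, hx1, hx2, hx3⟩ := hcon w hw'.1 hw'.2
    unfold adjPairs
    rw [Finset.sum_singleton]
    refine le_trans (by simp [hx3]) (Finset.single_le_sum (fun y _ => ?_)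
      (Finset.mem_sdiff.2 ⟨hx1, fun hx =>
        hx2 (Finset.mem_filter.1 hx).1 (Finset.mem_filter.1 hx).2⟩))
    split_ifs <;> simp
  have hrest : adjPairs G N N + adjPairs G (W' \ Q) (W' \ Q) ≤
      adjPairs G (W \ Q) (W \ Q) := by
    have hsub : N ⊆ W \ Q := fun x hx => Finset.mem_sdiff.2
      ⟨hN hx, fun hxQ => (Finset.mem_sdiff.1 (hQW' hxQ)).2 hx⟩
    rw [adjPairs_sdiff_self G hsub]
    have : (W \ Q) \ N = W' \ Q := by ext x; simp [hW']; tauto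
    rw [this]
    have := adjPairs_nonneg G N (W' \ Q)
    linarith
  have hW'cl := sum_clique_le_adjPairs G hf hadj
  have hW'Qcl := sum_clique_le_adjPairs G (W := W' \ Q) (a := a) (f := f)
    (fun v hv => hf v (Finset.sdiff_subset hv))
    (fun u hu v hv => hadj u (Finset.sdiff_subset hu) v (Finset.sdiff_subset hv))
  rw [← Finset.add_sum_erase _ _ (Finset.mem_range.2 hi)] at hW'cl hW'Qcl
  have hcongr : ∀ j ∈ (Finset.range a).erase i,
      ((#{v ∈ W' \ Q | f v = j} : ℤ) * (#{v ∈ W' \ Q | f v = j} - 1)) =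
      ((#{v ∈ W' | f v = j} : ℤ) * (#{v ∈ W' | f v = j} - 1)) := by
    intro j hj
    have : {v ∈ W' \ Q | f v = j} = {v ∈ W' | f v = j} := by
      ext v
      have := (Finset.mem_erase.1 hj).1
      simp only [Finset.mem_filter, Finset.mem_sdiff, hQ]
      constructor
      · rintro ⟨⟨h1, _⟩, h2⟩; exact ⟨h1, h2⟩
      · rintro ⟨h1, h2⟩; exact ⟨⟨h1, fun h => this (h2.symm.trans h.2)⟩, h2⟩
    rw [this]
  rw [Finset.sum_congr rfl hcongr] at hW'Qcl
  have hzero := mul_sub_one_nonneg (#{v ∈ W' \ Q | f v = i} : ℤ)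
  have hcard : (∑ j ∈ Finset.range a, (#{v ∈ W' | f v = j} : ℤ)) = #W' := by
    rw [← Nat.cast_sum, ← Finset.card_eq_sum_card_fiberwise]
    exact fun v hv => Finset.mem_coe.2 (Finset.mem_range.2 (hf v hv))
  have hconv : (a : ℤ) * (k * (k - 1)) + 2 * k * (#W' - k * a) + (#Q - k) * (#Q - k - 1) ≤
      (#Q : ℤ) * (#Q - 1) + ∑ j ∈ (Finset.range a).erase i,
        ((#{v ∈ W' | f v = j} : ℤ) * (#{v ∈ W' | f v = j} - 1)) := by
    have h1 : ∑ j ∈ (Finset.range a).erase i,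
        (k * (k - 1) + 2 * k * ((#{v ∈ W' | f v = j} : ℤ) - k)) ≤
        ∑ j ∈ (Finset.range a).erase i,
        ((#{v ∈ W' | f v = j} : ℤ) * (#{v ∈ W' | f v = j} - 1)) := by
      refine Finset.sum_le_sum fun j _ => ?_
      rw [mul_sub_one_eq k]
      have := mul_sub_one_nonneg ((#{v ∈ W' | f v = j} : ℤ) - k)
      linarith
    have h2 : ∑ j ∈ Finset.range a,
        (k * (k - 1) + 2 * k * ((#{v ∈ W' | f v = j} : ℤ) - k)) =
        (a : ℤ) * (k * (k - 1)) + 2 * k * (#W' - k * a) := by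
      rw [Finset.sum_add_distrib, Finset.sum_const, ← Finset.mul_sum, Finset.sum_sub_distrib, hcard]
      simp only [Finset.sum_const, Finset.card_range, nsmul_eq_mul]
      ring
    rw [← Finset.add_sum_erase _ _ (Finset.mem_range.2 hi)] at h2
    have h3 := mul_sub_one_eq k (#Q : ℤ)
    linarith
  have hcardW : (#W' : ℤ) = #W - #N := by
    rw [hW', Finset.card_sdiff_of_subset hN, Nat.cast_sub (Finset.card_le_card hN)]
  -- Adding `e1` and `e2` cancels the pairs inside `N`; with `hdeg` and the clique bounds, half the
  -- sum gives at least n(n - 1) + q + Σ qᵢ(qᵢ - 1) pairs in `W`, where n = #N, q = #Q and the qᵢ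
  -- are the clique orders. Beyond the linear bound there remains q + (q - k)(q - k - 1) = k + (q -
  -- k)², which exceeds C.
  have e1 := adjPairs_sdiff_self G hQW
  have e2 := adjPairs_sdiff_self G hN
  have e3 := adjPairs_sdiff_right G N hN
  have e4 := mul_sub_one_eq k (#N : ℤ)
  have e5 := mul_sub_one_nonneg ((#N : ℤ) - k)
  rw [← hW'] at e2 e3
  rw [hcardW] at hconv
  have e6 : (0 : ℤ) ≤ (#Q - k) ^ 2 := sq_nonneg _
  rw [← hQ] at hW'cl
  nlinarith

/-- A graph with few edges whose independent sets have at most `a` vertices splits into `a`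
cliques: a stability version of Turán's theorem. -/
theorem exists_clique_partition {k C : ℤ} (hC : C < k) (a : ℕ) (W : Finset V)
    (hind : ∀ I ⊆ W, (∀ u ∈ I, ∀ v ∈ I, u ≠ v → ¬ G.Adj u v) → #I ≤ a)
    (hE : adjPairs G W W ≤ a * (k * (k - 1)) + 2 * k * (#W - k * a) + C) :
    ∃ f : V → ℕ, (∀ v ∈ W, f v < a) ∧
      ∀ u ∈ W, ∀ v ∈ W, u ≠ v → f u = f v → G.Adj u v := by
  classical
  induction a generalizing W with
  | zero =>
    have : W = ∅ := by
      by_contra h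
      obtain ⟨v, hv⟩ := Finset.nonempty_iff_ne_empty.2 h
      have := hind {v} (by simpa using hv) (by simp)
      simp at this
    subst this
    exact ⟨fun _ => 0, by simp, by simp⟩
  | succ a ih =>
    rcases W.eq_empty_or_nonempty with rfl | hW
    · exact ⟨fun _ => 0, by simp, by simp⟩
    -- The closed neighbourhood `N` of a vertex of minimum degree is the candidate for the last
    -- clique: removing it lowers the independence number and at least n(n - 1) ordered pairs, n =
    -- #N, which keeps the edge budget for `a` cliques.
    obtain ⟨v, hv, hmin⟩ := Finset.exists_min_image W (fun u => adjPairs G {u} W) hW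
    set N := insert v {w ∈ W | G.Adj v w} with hNdef
    have hN : N ⊆ W := by
      intro w hw
      rcases Finset.mem_insert.1 hw with rfl | hw
      · exact hv
      · exact (Finset.mem_filter.1 hw).1
    have hcardN : adjPairs G {v} W = #N - 1 := by
      rw [hNdef, Finset.card_insert_of_notMem (by simp)]
      simp [adjPairs]
    have hdeg : (#N : ℤ) * (#N - 1) ≤ adjPairs G N W :=
      card_mul_le_adjPairs G fun u hu => hcardN ▸ hmin u (hN hu)
    have hcardW : (#(W \ N) : ℤ) = #W - #N := by
      rw [Finset.card_sdiff_of_subset hN, Nat.cast_sub (Finset.card_le_card hN)]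
    have e2 := adjPairs_sdiff_self G hN
    have e3 := adjPairs_sdiff_right G N hN
    have e4 := mul_sub_one_eq k (#N : ℤ)
    have e5 := mul_sub_one_nonneg ((#N : ℤ) - k)
    have e6 := adjPairs_self_le G N
    push_cast at hE
    obtain ⟨f, hf, hadj⟩ := ih (W \ N) (fun I hI hIind => by
      have hvI : v ∉ I := fun h => (Finset.mem_sdiff.1 (hI h)).2 (Finset.mem_insert_self _ _)
      have hvadj : ∀ u ∈ I, ¬ G.Adj v u := fun u hu h =>
        (Finset.mem_sdiff.1 (hI hu)).2 (Finset.mem_insert_of_mem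
          (Finset.mem_filter.2 ⟨(Finset.mem_sdiff.1 (hI hu)).1, h⟩))
      have := hind (insert v I) (Finset.insert_subset hv (hI.trans Finset.sdiff_subset)) (by
        intro x hx y hy hxy
        rcases Finset.mem_insert.1 hx with hxv | hxI <;>
          rcases Finset.mem_insert.1 hy with hyv | hyI
        · exact absurd (hxv.trans hyv.symm) hxy
        · exact hxv ▸ hvadj y hyI
        · exact fun h => hvadj x hxI (hyv ▸ h.symm)
        · exact hIind x hxI y hyI hxy)
      rw [Finset.card_insert_of_notMem hvI] at this
      omega) (by rw [hcardW]; linarith)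
    by_cases hcl : ∀ u ∈ N, ∀ w ∈ N, u ≠ w → G.Adj u w
    · refine ⟨fun w => if w ∈ N then a else f w, fun w hw => ?_, fun u hu w hw huw h => ?_⟩
      · dsimp only
        split_ifs with h
        · omega
        · have := hf w (Finset.mem_sdiff.2 ⟨hw, h⟩); omega
      · dsimp only at h
        split_ifs at h with h1 h2 h2
        · exact hcl u h1 w h2 huw
        · have := hf w (Finset.mem_sdiff.2 ⟨hw, h2⟩); omega
        · have := hf u (Finset.mem_sdiff.2 ⟨hu, h1⟩); omega
        · exact hadj u (Finset.mem_sdiff.2 ⟨hu, h1⟩) w (Finset.mem_sdiff.2 ⟨hw, h2⟩) huw h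
    · exfalso
      push Not at hcl
      -- If `N` is not a clique, two nonadjacent vertices of it together with one isolated
      -- representative of each of the `a` other cliques form an independent set of order a + 2.
      obtain ⟨x, hx, y, hy, hxy, hnadj⟩ := hcl
      have hiso : ∀ i : ℕ, i < a → ∃ w ∈ W \ N, f w = i ∧
          ∀ x ∈ W, ¬ (x ∈ W \ N ∧ f x = i) → ¬ G.Adj w x := fun i hi =>
        exists_isolated_from_compl G hC hN hf hadj hdeg hE hi
      have : Nonempty V := ⟨v⟩
      choose! w hw1 hw2 hw3 using hiso
      have hwinj : Set.InjOn w (Finset.range a) := by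
        intro i hi j hj hij
        rw [← hw2 i (by simpa using hi), ← hw2 j (by simpa using hj), hij]
      have hwN : ∀ i < a, ∀ z ∈ N, ¬ G.Adj (w i) z := fun i hi z hz =>
        hw3 i hi z (hN hz) fun h => (Finset.mem_sdiff.1 h.1).2 hz
      have hout : ∀ z ∈ N, z ∉ (Finset.range a).image w := by
        intro z hz h
        obtain ⟨i, hi, rfl⟩ := Finset.mem_image.1 h
        exact (Finset.mem_sdiff.1 (hw1 i (Finset.mem_range.1 hi))).2 hz
      have := hind (insert x (insert y ((Finset.range a).image w))) (by
        refine Finset.insert_subset (hN hx) (Finset.insert_subset (hN hy) ?_)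
        intro z hz
        obtain ⟨i, hi, rfl⟩ := Finset.mem_image.1 hz
        exact (Finset.mem_sdiff.1 (hw1 i (Finset.mem_range.1 hi))).1) (by
        intro p hp q hq hpq
        simp only [Finset.mem_insert, Finset.mem_image, Finset.mem_range] at hp hq
        rcases hp with rfl | rfl | ⟨i, hi, rfl⟩ <;> rcases hq with rfl | rfl | ⟨j, hj, rfl⟩
        · exact absurd rfl hpq
        · exact hnadj
        · exact fun h => hwN j hj _ hx h.symm
        · exact fun h => hnadj h.symm
        · exact absurd rfl hpq
        · exact fun h => hwN j hj _ hy h.symm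
        · exact hwN i hi _ hx
        · exact hwN i hi _ hy
        · refine hw3 i hi _ (Finset.mem_sdiff.1 (hw1 j hj)).1 fun h => hpq ?_
          rw [← h.2, hw2 j hj])
      rw [Finset.card_insert_of_notMem (by simp [hxy, hout x hx] : x ∉ insert y _),
        Finset.card_insert_of_notMem (hout y hy), Finset.card_image_of_injOn hwinj,
        Finset.card_range] at this
      omega

end AdjPairs

/-! ### Enumerating a connected graph with neighbours two places back. -/

section ZigzagOrder

theorem exists_adj_dist_lt {W : Type*} {T : SimpleGraph W} (hT : T.Connected) {p v : W}
    (h : v ≠ p) : ∃ v', T.Adj v v' ∧ T.dist p v' + 1 = T.dist p v := by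
  obtain ⟨q, hq⟩ := hT.exists_walk_length_eq_dist v p
  cases q with
  | nil => exact absurd rfl h
  | @cons _ v' _ hadj q =>
    refine ⟨v', hadj, ?_⟩
    rw [SimpleGraph.Walk.length_cons] at hq
    have h1 := SimpleGraph.dist_le q
    have h2 := hT.dist_triangle (u := v) (v := v') (w := p)
    rw [SimpleGraph.dist_eq_one_iff_adj.2 hadj] at h2
    rw [T.dist_comm (u := p), T.dist_comm (u := p)]
    omega

/-- Shortest paths from `p` to other vertices never pass through a farthest vertex. -/
theorem connected_induce_compl_of_farthest {W : Type*} {T : SimpleGraph W} (hT : T.Connected)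
    {p w : W} (hw : w ≠ p) (hmax : ∀ v, T.dist p v ≤ T.dist p w) :
    (T.induce ({w}ᶜ : Set W)).Connected := by
  have hp : p ∈ ({w}ᶜ : Set W) := fun h => hw h.symm
  have key : ∀ d : ℕ, ∀ v (hv : v ∈ ({w}ᶜ : Set W)), T.dist p v = d →
      (T.induce ({w}ᶜ : Set W)).Reachable ⟨v, hv⟩ ⟨p, hp⟩ := by
    intro d
    induction d with
    | zero =>
      intro v hv hd
      obtain rfl := hT.dist_eq_zero_iff.1 hd
      exact SimpleGraph.Reachable.refl _
    | succ d ih =>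
      intro v hv hd
      have hvp : v ≠ p := by rintro rfl; simp at hd
      obtain ⟨v', h1, h2⟩ := exists_adj_dist_lt hT hvp
      have hv' : v' ∈ ({w}ᶜ : Set W) := by
        rintro rfl
        have := hmax v
        omega
      have hadj : (T.induce ({w}ᶜ : Set W)).Adj ⟨v, hv⟩ ⟨v', hv'⟩ := h1
      exact hadj.reachable.trans (ih v' hv' (by omega))
  have : Nonempty ({w}ᶜ : Set W) := ⟨⟨p, hp⟩⟩
  exact SimpleGraph.Connected.mk fun a b =>
    (key _ a.1 a.2 rfl).trans (key _ b.1 b.2 rfl).symm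

/-- The vertices of a finite connected graph can be enumerated in such a way that every vertex
but the first has a neighbour at least two places earlier in the list (or the second vertex has
the first one as a neighbour). -/
theorem exists_zigzag_order {W : Type*} [Fintype W] (T : SimpleGraph W) (hT : T.Connected) :
    ∃ e : ℕ → W, (∀ v, ∃ j < Fintype.card W, e j = v) ∧
      ∀ j, 1 ≤ j → j < Fintype.card W → ∃ i ≤ j - 2, T.Adj (e i) (e j) := by
  classical
  induction hn : Fintype.card W using Nat.strong_induction_on generalizing W with
  | _ n ih =>
  -- A vertex adjacent to all others is put first. Otherwise two vertices are removed and placed at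
  -- the end of an enumeration of the rest.
  by_cases huniv : ∃ p, ∀ v, v ≠ p → T.Adj p v
  · obtain ⟨p, hp⟩ := huniv
    let q := (Fintype.equivFinOfCardEq hn)
    have hn0 : 0 < n := hn ▸ Fintype.card_pos_iff.2 ⟨p⟩
    let q' := q.trans (Equiv.swap (q p) ⟨0, hn0⟩)
    have hq' : q' p = ⟨0, hn0⟩ := by simp [q']
    have hq0 : q'.symm ⟨0, hn0⟩ = p := by rw [← hq', Equiv.symm_apply_apply]
    refine ⟨fun j => if h : j < n then q'.symm ⟨j, h⟩ else p, fun v => ⟨q' v, (q' v).2, by simp⟩,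
      fun j hj1 hjn => ⟨0, Nat.zero_le _, ?_⟩⟩
    simp only [hn0, hjn, dif_pos, hq0]
    refine hp _ fun h => ?_
    rw [← hq0, q'.symm.injective.eq_iff, Fin.mk.injEq] at h
    omega
  · push Not at huniv
    have := hT.nonempty
    obtain ⟨v0⟩ := hT.nonempty
    obtain ⟨v1, hv1, _⟩ := huniv v0
    have : Nontrivial W := ⟨⟨v1, v0, hv1⟩⟩
    obtain ⟨u, hu⟩ := hT.exists_connected_induce_compl_singleton_of_finite_nontrivial
    obtain ⟨p, hup⟩ := hT.preconnected.exists_adj_of_nontrivial u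
    obtain ⟨v, hvp, hpv⟩ := huniv p
    set H := T.induce ({u}ᶜ : Set W) with hH
    have hpu : p ∈ ({u}ᶜ : Set W) := fun h => hup.ne h.symm
    have hvu : v ∈ ({u}ᶜ : Set W) := by rintro rfl; exact hpv hup.symm
    -- As `p` is not universal, a vertex `w` farthest from `p` in T - u has distance at least 2. So
    -- `w` has a neighbour `p'` other than `p`, and `u`, `w` attach to two different remaining
    -- vertices.
    obtain ⟨w, -, hw⟩ := Finset.exists_max_image Finset.univ (fun x => H.dist ⟨p, hpu⟩ x)
      ⟨⟨p, hpu⟩, Finset.mem_univ _⟩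
    have hw : ∀ x, H.dist ⟨p, hpu⟩ x ≤ H.dist ⟨p, hpu⟩ w := fun x => hw x (Finset.mem_univ _)
    have hd2 : 2 ≤ H.dist ⟨p, hpu⟩ ⟨v, hvu⟩ := by
      have h0 : H.dist ⟨p, hpu⟩ ⟨v, hvu⟩ ≠ 0 := fun h => by
        have := hu.dist_eq_zero_iff.1 h
        exact hvp (congrArg Subtype.val this).symm
      have h1 : H.dist ⟨p, hpu⟩ ⟨v, hvu⟩ ≠ 1 := fun h =>
        hpv (SimpleGraph.dist_eq_one_iff_adj.1 h : H.Adj _ _)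
      omega
    have hd2 := hd2.trans (hw ⟨v, hvu⟩)
    have hwp : w ≠ ⟨p, hpu⟩ := by rintro rfl; simp at hd2
    obtain ⟨p', hp'1, hp'2⟩ := exists_adj_dist_lt hu hwp
    have hp'p : p' ≠ ⟨p, hpu⟩ := by
      rintro rfl
      simp at hp'2
      omega
    have hconn := connected_induce_compl_of_farthest hu hwp hw
    have hcard1 : Fintype.card ({u}ᶜ : Set W) = n - 1 := by
      rw [Fintype.card_compl_set, hn]; simp
    have hcard2 : Fintype.card ({w}ᶜ : Set ({u}ᶜ : Set W)) = n - 2 := by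
      rw [Fintype.card_compl_set, hcard1]; simp; omega
    have hn1 : 0 < n := hn ▸ Fintype.card_pos
    obtain ⟨e, he1, he2⟩ := ih (n - 2) (by omega) (H.induce ({w}ᶜ : Set ({u}ᶜ : Set W))) hconn
      hcard2
    obtain ⟨i, hi, hip⟩ := he1 ⟨⟨p, hpu⟩, fun h => hwp (Set.mem_singleton_iff.1 h).symm⟩
    obtain ⟨i', hi', hip'⟩ := he1 ⟨p', fun h => hp'1.ne (Set.mem_singleton_iff.1 h).symm⟩
    have hii' : i ≠ i' := by
      rintro rfl
      rw [hip] at hip'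
      exact hp'p (congrArg Subtype.val hip').symm
    have key : ∀ x y : W, (∀ v, v = x ∨ v = y ∨ ∃ s : ({w}ᶜ : Set ({u}ᶜ : Set W)), s.1.1 = v) →
        (∃ a ≤ n - 4, T.Adj (e a).1.1 x) → (∃ b < n - 2, T.Adj (e b).1.1 y) →
        ∃ e : ℕ → W, (∀ v, ∃ j < n, e j = v) ∧
          ∀ j, 1 ≤ j → j < n → ∃ i ≤ j - 2, T.Adj (e i) (e j) := by
      rintro x y hxy ⟨a, ha, hax⟩ ⟨b, hb, hby⟩
      refine ⟨fun j => if j < n - 2 then (e j).1.1 else if j = n - 2 then x else y,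
        fun v => ?_, fun j hj hjn => ?_⟩
      · rcases hxy v with rfl | rfl | ⟨s, rfl⟩
        · exact ⟨n - 2, by omega, by simp⟩
        · exact ⟨n - 1, by omega, by
            dsimp only
            rw [if_neg (by omega), if_neg (by omega)]⟩
        · obtain ⟨j, hj, rfl⟩ := he1 s
          exact ⟨j, by omega, by simp [hj]⟩
      · dsimp only
        by_cases h1 : j < n - 2
        · obtain ⟨i, hi, hadj⟩ := he2 j hj h1
          refine ⟨i, hi, ?_⟩
          rw [if_pos h1, if_pos (by omega)]
          exact hadj
        · by_cases h2 : j = n - 2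
          · refine ⟨a, by omega, ?_⟩
            rw [if_neg h1, if_pos h2, if_pos (by omega)]
            exact hax
          · refine ⟨b, by omega, ?_⟩
            rw [if_neg h1, if_neg h2, if_pos (by omega)]
            exact hby
    have hcover : ∀ v, v = u ∨ v = w.1 ∨ ∃ s : ({w}ᶜ : Set ({u}ᶜ : Set W)), s.1.1 = v := by
      intro v
      by_cases h1 : v = u
      · exact Or.inl h1
      · by_cases h2 : v = w.1
        · exact Or.inr (Or.inl h2)
        · exact Or.inr (Or.inr ⟨⟨⟨v, h1⟩, fun h => h2 (congrArg Subtype.val h)⟩, rfl⟩)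
    have hau : T.Adj (e i).1.1 u := by rw [hip]; exact hup.symm
    have haw : T.Adj (e i').1.1 w.1 := by rw [hip']; exact hp'1.symm
    -- Place n - 2 needs a neighbour at n - 4 or earlier; place n - 1 accepts any of the first n - 2
    -- places. Only one of `i`, `i'` can be n - 3, and the vertex attached there goes last.
    by_cases h : i ≤ n - 4
    · exact key u w.1 hcover ⟨i, h, hau⟩ ⟨i', hi', haw⟩
    · exact key w.1 u (fun v => by rcases hcover v with h | h | h <;> simp [h])
        ⟨i', by omega, haw⟩ ⟨i, hi, hau⟩

end ZigzagOrder

/-! ### Lifting clique weights to a test vector. -/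

section RankedCliqueTree

variable {V : Type*}

/-- The vertices of `G` are split into cliques of order `k` with ranks `0, …, α - 1`, and for
`1 ≤ j < α` the edge from `a j` to `b j` joins the clique of rank `j` to its parent, which has
rank `p j ≤ j - 2` (or rank `0` if `j = 1`). -/
structure IsRankedCliqueTree [Fintype V] (G : SimpleGraph V) (k α : ℕ) (F : V → ℕ) (p : ℕ → ℕ)
    (a b : ℕ → V) : Prop where
  rank_lt : ∀ v, F v < α
  card_rank : ∀ r < α, ∑ v, (if F v = r then 1 else 0) = k
  adj_of_rank_eq : ∀ u v, u ≠ v → F u = F v → G.Adj u v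
  rank_a : ∀ j ∈ Finset.Ico 1 α, F (a j) = j
  rank_b : ∀ j ∈ Finset.Ico 1 α, F (b j) = p j
  parent_le : ∀ j ∈ Finset.Ico 1 α, p j ≤ j - 2
  adj_link : ∀ j ∈ Finset.Ico 1 α, G.Adj (a j) (b j)

open Classical in
/-- The sum of `y` over the vertices that are linked to `v` by one of the edges `a j`, `b j`. -/
noncomputable def linkSum (α : ℕ) (a b : ℕ → V) (y : V → ℝ) (v : V) : ℝ :=
  ∑ j ∈ Finset.Ico 1 α, ((if v = a j then y (b j) else 0) + (if v = b j then y (a j) else 0))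

/-- The vertex weight of an edge that joins a clique of weight `x` to a clique of weight `y`. -/
noncomputable def linkWeight (L x y : ℝ) : ℝ := x / L + y

open Classical in
/-- The extension of the weights `z` of the cliques to weights of the vertices. -/
noncomputable def cliqueLift (L : ℝ) (α : ℕ) (F : V → ℕ) (p : ℕ → ℕ) (a b : ℕ → V) (z : ℕ → ℝ)
    (v : V) : ℝ :=
  z (F v) / L + (∑ j ∈ Finset.Ico 1 α, ((if v = a j then linkWeight L (z j) (z (p j)) else 0) +
    (if v = b j then linkWeight L (z (p j)) (z j) else 0))) / (L ^ 2 - 1)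

/-- The weight of the edges at the clique of rank `r`. -/
noncomputable def rankSum (L : ℝ) (α : ℕ) (p : ℕ → ℕ) (z : ℕ → ℝ) (r : ℕ) : ℝ :=
  ∑ j ∈ Finset.Ico 1 α, ((if j = r then linkWeight L (z j) (z (p j)) else 0) +
    (if p j = r then linkWeight L (z (p j)) (z j) else 0))

variable [Fintype V] {G : SimpleGraph V} {k α : ℕ} {F : V → ℕ} {p : ℕ → ℕ} {a b : ℕ → V}

namespace IsRankedCliqueTree

theorem parent_lt (T : IsRankedCliqueTree G k α F p a b) {j : ℕ} (hj : j ∈ Finset.Ico 1 α) :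
    p j < j := by
  have h1 := T.parent_le j hj
  have h2 := (Finset.mem_Ico.1 hj).1
  omega

theorem parent_lt_card (T : IsRankedCliqueTree G k α F p a b) {j : ℕ}
    (hj : j ∈ Finset.Ico 1 α) : p j < α :=
  (T.parent_lt hj).trans (Finset.mem_Ico.1 hj).2

theorem a_ne_b (T : IsRankedCliqueTree G k α F p a b) {j : ℕ} (hj : j ∈ Finset.Ico 1 α) :
    a j ≠ b j := (T.adj_link j hj).ne

open Classical in
/-- The part of the adjacency matrix given by the cliques and the links is at most the whole
matrix. -/
theorem entry_le (T : IsRankedCliqueTree G k α F p a b) (v w : V) :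
    (if F w = F v then 1 else 0) - (if w = v then 1 else 0) +
      ∑ j ∈ Finset.Ico 1 α, ((if v = a j ∧ w = b j then 1 else 0) +
        (if v = b j ∧ w = a j then 1 else 0)) ≤ (if G.Adj v w then (1 : ℝ) else 0) := by
  have hA : ∀ j ∈ Finset.Ico 1 α, v = a j ∧ w = b j → F v = j ∧ F w < F v ∧ G.Adj v w := by
    rintro j hj ⟨rfl, rfl⟩
    rw [T.rank_a j hj, T.rank_b j hj]
    exact ⟨rfl, T.parent_lt hj, T.adj_link j hj⟩
  have hB : ∀ j ∈ Finset.Ico 1 α, v = b j ∧ w = a j → F w = j ∧ F v < F w ∧ G.Adj v w := by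
    rintro j hj ⟨rfl, rfl⟩
    rw [T.rank_a j hj, T.rank_b j hj]
    exact ⟨rfl, T.parent_lt hj, (T.adj_link j hj).symm⟩
  by_cases hF : F w = F v
  · have hz : ∀ j ∈ Finset.Ico 1 α, ((if v = a j ∧ w = b j then (1 : ℝ) else 0) +
        (if v = b j ∧ w = a j then 1 else 0)) = 0 := by
      intro j hj
      rw [if_neg fun h => (hA j hj h).2.1.ne hF, if_neg fun h => (hB j hj h).2.1.ne hF.symm]
      simp
    rw [Finset.sum_eq_zero hz, if_pos hF]
    by_cases hwv : w = v
    · simp [hwv]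
    · simp [hwv, T.adj_of_rank_eq v w (Ne.symm hwv) hF.symm]
  · have hwv : w ≠ v := fun h => hF (congrArg F h)
    rw [if_neg hF, if_neg hwv]
    -- A link goes from its own rank to a smaller one, so vertices of different ranks can be joined
    -- only by the link indexed by the larger rank, and no pair is counted twice.
    have hz : ∀ j ∈ Finset.Ico 1 α, j ≠ max (F v) (F w) →
        ((if v = a j ∧ w = b j then (1 : ℝ) else 0) +
          (if v = b j ∧ w = a j then 1 else 0)) = 0 := by
      intro j hj hne
      rw [if_neg fun h => hne (by have := hA j hj h; omega),
        if_neg fun h => hne (by have := hB j hj h; omega)]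
      simp
    by_cases hmem : max (F v) (F w) ∈ Finset.Ico 1 α
    · rw [Finset.sum_eq_single_of_mem _ hmem hz]
      by_cases h1 : v = a (max (F v) (F w)) ∧ w = b (max (F v) (F w))
      · have h2 := hA _ hmem h1
        rw [if_pos h1, if_neg fun h => by have := hB _ hmem h; omega, if_pos h2.2.2]
        norm_num
      · rw [if_neg h1]
        by_cases h3 : v = b (max (F v) (F w)) ∧ w = a (max (F v) (F w))
        · rw [if_pos h3, if_pos (hB _ hmem h3).2.2]; norm_num
        · rw [if_neg h3]; split_ifs <;> norm_num
    · rw [Finset.sum_eq_zero fun j hj => hz j hj fun h => hmem (h ▸ hj)]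
      split_ifs <;> norm_num

open Classical in
theorem sum_entry_mul (y : V → ℝ) (v : V) :
    ∑ w, ((if F w = F v then (1 : ℝ) else 0) - (if w = v then 1 else 0) +
      ∑ j ∈ Finset.Ico 1 α, ((if v = a j ∧ w = b j then 1 else 0) +
        (if v = b j ∧ w = a j then 1 else 0))) * y w =
      (∑ w, if F w = F v then y w else 0) - y v + linkSum α a b y v := by
  simp only [add_mul, sub_mul, Finset.sum_add_distrib, Finset.sum_sub_distrib, linkSum]
  congr 1
  · simp
  · simp only [Finset.sum_mul]
    rw [Finset.sum_comm, Finset.sum_comm (s := (Finset.univ : Finset V)),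
      ← Finset.sum_add_distrib, ← Finset.sum_add_distrib]
    refine Finset.sum_congr rfl fun j _ => ?_
    simp [ite_and]

-- Because y is positive, equality at `v` forces equality of every entry in its row, which excludes
-- edges beyond cliques and links.
open Classical in
theorem le_adjSum (T : IsRankedCliqueTree G k α F p a b) {y : V → ℝ} (hy : ∀ v, 0 < y v) (v : V) :
    (∑ w, if F w = F v then y w else 0) - y v + linkSum α a b y v ≤ G.adjSum y v ∧
    (G.adjSum y v = (∑ w, if F w = F v then y w else 0) - y v + linkSum α a b y v →
      ∀ w, G.Adj v w → F v ≠ F w →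
        ∃ j ∈ Finset.Ico 1 α, (v = a j ∧ w = b j) ∨ (v = b j ∧ w = a j)) := by
  rw [← sum_entry_mul]
  have h : G.adjSum y v = ∑ w, (if G.Adj v w then (1 : ℝ) else 0) * y w := by
    simp [SimpleGraph.adjSum]
  rw [h]
  have hle := fun w (_ : w ∈ Finset.univ) =>
    mul_le_mul_of_nonneg_right (T.entry_le v w) (hy w).le
  refine ⟨Finset.sum_le_sum hle, fun heq w hvw hF => ?_⟩
  have := (Finset.sum_eq_sum_iff_of_le hle).1 heq.symm w (Finset.mem_univ w)
  have := mul_right_cancel₀ (hy w).ne' this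
  by_contra! hcon
  rw [if_neg (Ne.symm hF), if_neg fun h => hF (congrArg F h.symm), if_pos hvw,
    Finset.sum_eq_zero] at this
  · norm_num at this
  · intro j hj
    rw [if_neg fun h => (hcon j hj).1 h.1 h.2, if_neg fun h => (hcon j hj).2 h.1 h.2]
    simp

section Lift

variable {L : ℝ} {z : ℕ → ℝ}

theorem linkWeight_pos (T : IsRankedCliqueTree G k α F p a b) (hL : 1 < L)
    (hz : ∀ r < α, 0 < z r) {j : ℕ} (hj : j ∈ Finset.Ico 1 α) :
    0 < linkWeight L (z j) (z (p j)) ∧ 0 < linkWeight L (z (p j)) (z j) := by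
  have h1 := hz j (Finset.mem_Ico.1 hj).2
  have h2 := hz _ (T.parent_lt_card hj)
  unfold linkWeight
  constructor <;> positivity

theorem le_cliqueLift (T : IsRankedCliqueTree G k α F p a b) (hL : 1 < L)
    (hz : ∀ r < α, 0 < z r) {s : Finset ℕ} (hs : s ⊆ Finset.Ico 1 α) (v : V) :
    open Classical in
    z (F v) / L + (∑ j ∈ s, ((if v = a j then linkWeight L (z j) (z (p j)) else 0) +
      (if v = b j then linkWeight L (z (p j)) (z j) else 0))) / (L ^ 2 - 1) ≤
    cliqueLift L α F p a b z v := by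
  classical
  unfold cliqueLift
  have hL2 : 0 < L ^ 2 - 1 := by nlinarith
  refine add_le_add le_rfl (div_le_div_of_nonneg_right ?_ hL2.le)
  refine Finset.sum_le_sum_of_subset_of_nonneg hs fun j hj _ => ?_
  have := T.linkWeight_pos hL hz hj
  split_ifs <;> linarith [this.1, this.2]

theorem cliqueLift_pos (T : IsRankedCliqueTree G k α F p a b) (hL : 1 < L)
    (hz : ∀ r < α, 0 < z r) (v : V) : 0 < cliqueLift L α F p a b z v := by
  have := T.le_cliqueLift hL hz (Finset.empty_subset _) v
  have h1 := hz _ (T.rank_lt v)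
  simp only [Finset.sum_empty, zero_div, add_zero] at this
  exact lt_of_lt_of_le (by positivity) this

/-- Both sides equal (L x + y)/(L² - 1), the first coordinate of the solution of L u = x + u', L u'
= y + u. These are the eigenvector equations at the ends of an isolated link between cliques of sums
x and y. -/
theorem link_identity (hL : 1 < L) (x y : ℝ) :
    x / L + linkWeight L x y / (L ^ 2 - 1) = L * (linkWeight L y x / (L ^ 2 - 1)) := by
  have hL2 : L ^ 2 - 1 ≠ 0 := by nlinarith
  have hL0 : L ≠ 0 := by linarith
  unfold linkWeight
  field_simp
  ring

theorem le_cliqueLift_a (T : IsRankedCliqueTree G k α F p a b) (hL : 1 < L)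
    (hz : ∀ r < α, 0 < z r) {j : ℕ} (hj : j ∈ Finset.Ico 1 α) :
    L * (linkWeight L (z (p j)) (z j) / (L ^ 2 - 1)) ≤ cliqueLift L α F p a b z (a j) := by
  classical
  have := T.le_cliqueLift hL hz (Finset.singleton_subset_iff.2 hj) (a j)
  rw [Finset.sum_singleton, if_pos rfl, if_neg (T.a_ne_b hj), add_zero, T.rank_a j hj,
    link_identity hL] at this
  exact this

theorem le_cliqueLift_b (T : IsRankedCliqueTree G k α F p a b) (hL : 1 < L)
    (hz : ∀ r < α, 0 < z r) {j : ℕ} (hj : j ∈ Finset.Ico 1 α) :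
    L * (linkWeight L (z j) (z (p j)) / (L ^ 2 - 1)) ≤ cliqueLift L α F p a b z (b j) := by
  classical
  have := T.le_cliqueLift hL hz (Finset.singleton_subset_iff.2 hj) (b j)
  rw [Finset.sum_singleton, if_pos rfl, if_neg (T.a_ne_b hj).symm, zero_add, T.rank_b j hj,
    link_identity hL] at this
  exact this

/-- A second link at the same vertex would add a strictly positive term to the lift there. -/
theorem a_ne_b_of_cliqueLift_le (T : IsRankedCliqueTree G k α F p a b) (hL : 1 < L)
    (hz : ∀ r < α, 0 < z r) {i j : ℕ} (hi : i ∈ Finset.Ico 1 α) (hj : j ∈ Finset.Ico 1 α)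
    (h : cliqueLift L α F p a b z (a j) ≤ L * (linkWeight L (z (p j)) (z j) / (L ^ 2 - 1))) :
    a j ≠ b i := by
  classical
  intro hab
  have hij : i ≠ j := by
    rintro rfl
    exact T.a_ne_b hj hab
  have hL2 : 0 < L ^ 2 - 1 := by nlinarith
  have h1 := T.le_cliqueLift hL hz (s := {i, j})
    (Finset.insert_subset hi (Finset.singleton_subset_iff.2 hj)) (a j)
  have hai : a j ≠ a i := fun h => hij (by rw [← T.rank_a j hj, ← T.rank_a i hi, h])
  rw [Finset.sum_pair hij, if_pos rfl, if_neg (T.a_ne_b hj), if_neg hai, if_pos hab,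
    T.rank_a j hj, add_zero, zero_add, add_div] at h1
  have h2 := link_identity hL (z j) (z (p j))
  have h3 := div_pos (T.linkWeight_pos hL hz hi).2 hL2
  linarith

theorem b_injOn_of_cliqueLift_le (T : IsRankedCliqueTree G k α F p a b) (hL : 1 < L)
    (hz : ∀ r < α, 0 < z r) {i j : ℕ} (hi : i ∈ Finset.Ico 1 α) (hj : j ∈ Finset.Ico 1 α)
    (h : cliqueLift L α F p a b z (b j) ≤ L * (linkWeight L (z j) (z (p j)) / (L ^ 2 - 1)))
    (hb : b j = b i) : j = i := by
  classical
  by_contra hji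
  have hij : i ≠ j := Ne.symm hji
  have hL2 : 0 < L ^ 2 - 1 := by nlinarith
  have h1 := T.le_cliqueLift hL hz (s := {i, j})
    (Finset.insert_subset hi (Finset.singleton_subset_iff.2 hj)) (b j)
  have hlow : linkWeight L (z (p i)) (z i) + linkWeight L (z (p j)) (z j) ≤
      ∑ l ∈ {i, j}, ((if b j = a l then linkWeight L (z l) (z (p l)) else 0) +
      (if b j = b l then linkWeight L (z (p l)) (z l) else 0)) := by
    rw [Finset.sum_pair hij, if_pos hb, if_pos rfl]
    have h5 := (T.linkWeight_pos hL hz hi).1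
    have h6 := (T.linkWeight_pos hL hz hj).1
    split_ifs <;> linarith
  have h2 := link_identity hL (z (p j)) (z j)
  have h3 := div_pos (T.linkWeight_pos hL hz hi).2 hL2
  have h4 := div_le_div_of_nonneg_right hlow hL2.le
  rw [T.rank_b j hj] at h1
  rw [add_div] at h4
  linarith

/-- L times the lift at `v` is the clique weight plus, for each link at `v`, the value the other end
would have if it met no other link. The actual values are at least that; equality leaves no room for
shared ends. -/
theorem mul_cliqueLift_sub_linkSum_le (T : IsRankedCliqueTree G k α F p a b) (hL : 1 < L)
    (hz : ∀ r < α, 0 < z r) (v : V) :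
    L * cliqueLift L α F p a b z v - linkSum α a b (cliqueLift L α F p a b z) v ≤ z (F v) ∧
    (L * cliqueLift L α F p a b z v - linkSum α a b (cliqueLift L α F p a b z) v = z (F v) →
      ∀ j ∈ Finset.Ico 1 α,
      (v = a j → cliqueLift L α F p a b z (b j) ≤
        L * (linkWeight L (z j) (z (p j)) / (L ^ 2 - 1))) ∧
      (v = b j → cliqueLift L α F p a b z (a j) ≤
        L * (linkWeight L (z (p j)) (z j) / (L ^ 2 - 1)))) := by
  classical
  set y := cliqueLift L α F p a b z with hy
  have hLy : L * y v = z (F v) + ∑ j ∈ Finset.Ico 1 α,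
      ((if v = a j then L * (linkWeight L (z j) (z (p j)) / (L ^ 2 - 1)) else 0) +
      (if v = b j then L * (linkWeight L (z (p j)) (z j) / (L ^ 2 - 1)) else 0)) := by
    rw [hy]
    unfold cliqueLift
    rw [mul_add, mul_div_cancel₀ _ (by linarith : L ≠ 0), Finset.sum_div, Finset.mul_sum]
    congr 1
    refine Finset.sum_congr rfl fun j _ => ?_
    split_ifs <;> ring
  have hle : ∀ j ∈ Finset.Ico 1 α,
      ((if v = a j then L * (linkWeight L (z j) (z (p j)) / (L ^ 2 - 1)) else 0) +
      (if v = b j then L * (linkWeight L (z (p j)) (z j) / (L ^ 2 - 1)) else 0)) ≤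
      ((if v = a j then y (b j) else 0) + (if v = b j then y (a j) else 0)) := by
    intro j hj
    have h1 := T.le_cliqueLift_a hL hz hj
    have h2 := T.le_cliqueLift_b hL hz hj
    refine add_le_add ?_ ?_ <;> split_ifs <;> simp [hy, h1, h2]
  have hsum := Finset.sum_le_sum hle
  refine ⟨?_, fun heq j hj => ?_⟩
  · unfold linkSum
    linarith
  · unfold linkSum at heq
    have := (Finset.sum_eq_sum_iff_of_le hle).1 (by linarith) j hj
    constructor
    · rintro rfl
      rw [if_pos rfl, if_neg (T.a_ne_b hj), if_pos rfl, if_neg (T.a_ne_b hj)] at this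
      linarith
    · rintro rfl
      rw [if_pos rfl, if_neg (T.a_ne_b hj).symm, if_pos rfl, if_neg (T.a_ne_b hj).symm] at this
      linarith

open Classical in
theorem sum_rank_cliqueLift (T : IsRankedCliqueTree G k α F p a b) {r : ℕ} (hr : r < α) :
    ∑ v, (if F v = r then cliqueLift L α F p a b z v else 0) =
      k * (z r / L) + rankSum L α p z r / (L ^ 2 - 1) := by
  have h1 : ∀ v, (if F v = r then cliqueLift L α F p a b z v else 0) =
      ((if F v = r then (1 : ℕ) else 0 : ℕ) : ℝ) * (z r / L) +
      (∑ j ∈ Finset.Ico 1 α, ((if v = a j then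
        (if F v = r then linkWeight L (z j) (z (p j)) else 0) else 0) +
        (if v = b j then (if F v = r then linkWeight L (z (p j)) (z j) else 0) else 0))) /
        (L ^ 2 - 1) := by
    intro v
    by_cases h : F v = r
    · simp [h, cliqueLift]
    · simp [h]
  simp only [h1]
  rw [Finset.sum_add_distrib, ← Finset.sum_mul, ← Nat.cast_sum, T.card_rank r hr,
    ← Finset.sum_div, Finset.sum_comm]
  congr 2
  unfold rankSum
  refine Finset.sum_congr rfl fun j hj => ?_
  rw [Finset.sum_add_distrib]
  simp [T.rank_a j hj, T.rank_b j hj]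

/-- Regrouping by links turns the sum over cliques into a sum of edge forms. -/
theorem sum_mul_rankSum (T : IsRankedCliqueTree G k α F p a b) :
    ∑ r ∈ Finset.range α, z r * rankSum L α p z r =
      ∑ j ∈ Finset.Ico 1 α, (z j * linkWeight L (z j) (z (p j)) +
        z (p j) * linkWeight L (z (p j)) (z j)) := by
  simp only [rankSum, Finset.mul_sum]
  rw [Finset.sum_comm]
  refine Finset.sum_congr rfl fun j hj => ?_
  simp only [mul_add, Finset.sum_add_distrib, mul_ite, mul_zero]
  rw [Finset.sum_ite_eq, Finset.sum_ite_eq, if_pos, if_pos]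
  · exact Finset.mem_range.2 (T.parent_lt_card hj)
  · exact Finset.mem_range.2 (Finset.mem_Ico.1 hj).2

end Lift

end IsRankedCliqueTree

end RankedCliqueTree

/-! ### Comparing the tree of cliques with the path. -/

section Comparison

/-- The contribution of an edge between cliques of weights `x` and `y` to the quadratic form. -/
noncomputable def edgeForm (L x y : ℝ) : ℝ := x * linkWeight L x y + y * linkWeight L y x

/-- The form is (x² + y²)/L + 2xy, strictly increasing in y for positive arguments. -/
theorem edgeForm_le {L x y y' : ℝ} (hL : 1 < L) (hx : 0 < x) (hy : 0 < y) (h : y ≤ y') :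
    edgeForm L x y ≤ edgeForm L x y' ∧ (edgeForm L x y' = edgeForm L x y → y' = y) := by
  have h1 : edgeForm L x y' - edgeForm L x y = (y' - y) * ((y' + y) / L + 2 * x) := by
    unfold edgeForm linkWeight; ring
  have h2 : 0 < (y' + y) / L + 2 * x := by
    have : 0 < y' := by linarith
    positivity
  constructor
  · have := mul_nonneg (sub_nonneg.2 h) h2.le
    linarith
  · intro heq
    rw [heq, sub_self] at h1
    rcases mul_eq_zero.1 h1.symm with h3 | h3
    · linarith
    · exact absurd h3 h2.ne'

variable {V : Type*} [Fintype V] {G : SimpleGraph V} {k α : ℕ} {F : V → ℕ} {p : ℕ → ℕ}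
  {a b : ℕ → V} {L : ℝ} {z : ℕ → ℝ}

namespace IsRankedCliqueTree

/-- Ties z r = z (r + 1) may occur, so equal parent weights do not settle the parents. The only
other candidate is p j = j - 3 = r with such a tie; then the cliques r and r + 1 have equal weight
but different sums of link weights, against `heig`. -/
theorem parent_eq_sub_two (T : IsRankedCliqueTree G k α F p a b) (hL : 1 < L)
    (hz : ∀ r < α, 0 < z r) (hanti : ∀ i j, i ≤ j → j < α → z j ≤ z i)
    (hstrict : ∀ j, j + 2 < α → z (j + 2) < z j) {κ : ℝ}
    (heig : ∀ r < α, rankSum L α p z r = κ * z r)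
    (hp : ∀ j ∈ Finset.Ico 1 α, z (p j) = z (j - 2)) :
    ∀ j ∈ Finset.Ico 1 α, p j = j - 2 := by
  intro j
  induction j using Nat.strong_induction_on with
  | _ j ih =>
  intro hj
  have hj' := Finset.mem_Ico.1 hj
  have hle := T.parent_le j hj
  by_contra hne
  have h3 : p j + 3 ≤ j := by omega
  have hjr : j = p j + 3 := by
    by_contra hc
    have h1 := hanti (p j + 2) (j - 2) (by omega) (by omega)
    have h2 := hstrict (p j) (by omega)
    have h4 := hp j hj
    linarith
  generalize hr : p j = r at *
  have hzr : z (r + 1) = z r := by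
    have := hp j hj
    rw [hr] at this
    rw [this]
    congr 1; omega
  -- the clique of rank `r + 1` has no children
  have hleaf : ∀ i ∈ Finset.Ico 1 α, p i ≠ r + 1 := by
    intro i hi hpi
    have hi' := Finset.mem_Ico.1 hi
    have h1 := T.parent_le i hi
    by_cases h2 : i < j
    · have := ih i h2 hi
      omega
    · by_cases h4 : i = j
      · subst h4; omega
      · have h5 := hanti (r + 2) (i - 2) (by omega) (by omega)
        have h6 := hstrict r (by omega)
        have h7 := hp i hi
        rw [hpi] at h7
        linarith
  have hmem : ∀ i, 1 ≤ i → i ≤ j → i ∈ Finset.Ico 1 α := fun i h1 h2 =>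
    Finset.mem_Ico.2 ⟨h1, by omega⟩
  have e1 : rankSum L α p z (r + 1) = linkWeight L (z (r + 1)) (z (p (r + 1))) := by
    unfold rankSum
    rw [Finset.sum_eq_single_of_mem (r + 1) (hmem _ (by omega) (by omega)),
      if_pos rfl, if_neg (hleaf _ (hmem _ (by omega) (by omega))), add_zero]
    intro i hi hir
    rw [if_neg hir, if_neg (hleaf i hi), add_zero]
  have hnonneg : ∀ i ∈ Finset.Ico 1 α, 0 ≤
      ((if i = r then linkWeight L (z i) (z (p i)) else 0) +
      (if p i = r then linkWeight L (z (p i)) (z i) else 0)) := by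
    intro i hi
    have := T.linkWeight_pos hL hz hi
    split_ifs <;> linarith [this.1, this.2]
  have hpr2 : p (r + 2) = r := by
    have := ih (r + 2) (by omega) (hmem _ (by omega) (by omega))
    omega
  have hz0 := hz r (by omega)
  have hz2 := hz (r + 2) (by omega)
  have hz3 := hz (r + 3) (by omega)
  have hlw : ∀ x y, 0 < x → 0 < y → y < linkWeight L x y := by
    intro x y hx hy
    unfold linkWeight
    have : 0 < x / L := by positivity
    linarith
  have e2 := heig r (by omega)
  have e3 := heig (r + 1) (by omega)
  rw [e1, hzr] at e3
  -- Clique r + 1 has only its parent link. Clique r has a child r + 2 besides its parent link, or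
  -- besides the child 1 when r = 0, and that other link weighs at least as much.
  rcases Nat.eq_zero_or_pos r with h0 | h0
  · have hp1 : p (r + 1) = r := by
      have := T.parent_le (r + 1) (hmem _ (by omega) (by omega))
      omega
    have hsub : ({r + 1, r + 2} : Finset ℕ) ⊆ Finset.Ico 1 α :=
      Finset.insert_subset (hmem _ (by omega) (by omega))
        (Finset.singleton_subset_iff.2 (hmem _ (by omega) (by omega)))
    have h1 := Finset.sum_le_sum_of_subset_of_nonneg hsub fun i hi _ => hnonneg i hi
    rw [Finset.sum_pair (by omega), if_neg (by omega), if_pos hp1, if_neg (by omega),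
      if_pos hpr2, hp1, hpr2, hzr] at h1
    have h2 : rankSum L α p z r = linkWeight L (z r) (z r) := by rw [e2, ← e3, hp1]
    unfold rankSum at h2
    have := hlw (z r) (z (r + 2)) hz0 hz2
    linarith
  · have hsub : ({r, r + 2} : Finset ℕ) ⊆ Finset.Ico 1 α :=
      Finset.insert_subset (hmem _ (by omega) (by omega))
        (Finset.singleton_subset_iff.2 (hmem _ (by omega) (by omega)))
    have h1 := Finset.sum_le_sum_of_subset_of_nonneg hsub fun i hi _ => hnonneg i hi
    have hprr := ih r (by omega) (hmem r (by omega) (by omega))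
    have hprr1 := ih (r + 1) (by omega) (hmem (r + 1) (by omega) (by omega))
    rw [Finset.sum_pair (by omega), if_pos rfl, if_neg (by omega : ¬ p r = r), if_neg (by omega),
      if_pos hpr2, hpr2] at h1
    have h2 : rankSum L α p z r = linkWeight L (z r) (z (p (r + 1))) := by rw [e2, ← e3]
    unfold rankSum at h2
    have h4 := hlw (z r) (z (r + 2)) hz0 hz2
    have h5 : z (p (r + 1)) ≤ z (p r) := hanti _ _ (by omega) (by omega)
    have h6 : linkWeight L (z r) (z (p (r + 1))) ≤ linkWeight L (z r) (z (p r)) := by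
      unfold linkWeight; linarith
    linarith

/-- The Rayleigh quotient of the lift is at least L - 1, so `hle` turns every estimate on the way
into an equality. `hsum` is the only trace of the path: it gives the value of its edge forms. -/
theorem spectralRadius_comparison (T : IsRankedCliqueTree G k α F p a b) (hα : 1 ≤ α)
    (hk : 1 ≤ k) (hL : 1 < L)
    (hz : ∀ r < α, 0 < z r) (hanti : ∀ i j, i ≤ j → j < α → z j ≤ z i)
    (hstrict : ∀ j, j + 2 < α → z (j + 2) < z j)
    (hsum : ∑ j ∈ Finset.Ico 1 α, edgeForm L (z j) (z (j - 2)) =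
      (1 - k / L) * (L ^ 2 - 1) * ∑ r ∈ Finset.range α, z r ^ 2)
    (hle : graphSpectralRadius G ≤ L - 1) :
    (∀ j ∈ Finset.Ico 1 α, p j = j - 2) ∧
    (∀ v w, G.Adj v w → F v ≠ F w →
      ∃ j ∈ Finset.Ico 1 α, (v = a j ∧ w = b j) ∨ (v = b j ∧ w = a j)) ∧
    (∀ i ∈ Finset.Ico 1 α, ∀ j ∈ Finset.Ico 1 α, a i ≠ b j) ∧
    (∀ i ∈ Finset.Ico 1 α, ∀ j ∈ Finset.Ico 1 α, b i = b j → i = j) := by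
  classical
  have hL2 : 0 < L ^ 2 - 1 := by nlinarith
  have hL0 : L ≠ 0 := by linarith
  set y := cliqueLift L α F p a b z with hy
  have hypos : ∀ v, 0 < y v := fun v => T.cliqueLift_pos hL hz v
  set W : ℕ → ℝ := fun r => ∑ v, if F v = r then y v else 0 with hW
  have hWeq : ∀ r < α, W r = k * (z r / L) + rankSum L α p z r / (L ^ 2 - 1) :=
    fun r hr => T.sum_rank_cliqueLift hr
  have hpt : ∀ v, W (F v) - z (F v) ≤ G.adjSum y v - (L - 1) * y v := by
    intro v
    have h1 := (T.le_adjSum hypos v).1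
    have h2 := (T.mul_cliqueLift_sub_linkSum_le hL hz v).1
    rw [← hy] at h2
    simp only [hW]
    linarith
  have hfiber : ∀ g : ℕ → ℝ, ∑ v, y v * g (F v) = ∑ r ∈ Finset.range α, W r * g r := by
    intro g
    simp only [hW, Finset.sum_mul, ite_mul, zero_mul]
    rw [Finset.sum_comm]
    refine Finset.sum_congr rfl fun v _ => ?_
    rw [Finset.sum_ite_eq, if_pos (Finset.mem_range.2 (T.rank_lt v))]
  have hedge : ∀ j ∈ Finset.Ico 1 α,
      edgeForm L (z j) (z (j - 2)) ≤ edgeForm L (z j) (z (p j)) ∧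
      (edgeForm L (z j) (z (p j)) = edgeForm L (z j) (z (j - 2)) → z (p j) = z (j - 2)) := by
    intro j hj
    have h1 := Finset.mem_Ico.1 hj
    exact edgeForm_le hL (hz _ h1.2) (hz _ (by omega)) (hanti _ _ (T.parent_le j hj) (by omega))
  have hedges := Finset.sum_le_sum fun j hj => (hedge j hj).1
  have hzW : ∑ r ∈ Finset.range α, z r * (W r - z r) =
      (∑ j ∈ Finset.Ico 1 α, edgeForm L (z j) (z (p j)) -
        ∑ j ∈ Finset.Ico 1 α, edgeForm L (z j) (z (j - 2))) / (L ^ 2 - 1) := by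
    have h1 : ∀ r ∈ Finset.range α, z r * (W r - z r) =
        z r * rankSum L α p z r / (L ^ 2 - 1) - (1 - k / L) * z r ^ 2 := by
      intro r hr
      rw [hWeq r (Finset.mem_range.1 hr)]
      ring
    rw [Finset.sum_congr rfl h1, Finset.sum_sub_distrib, ← Finset.sum_div, T.sum_mul_rankSum,
      ← Finset.mul_sum, hsum, sub_div]
    congr 1
    field_simp
  have hzW0 : 0 ≤ ∑ r ∈ Finset.range α, z r * (W r - z r) := by
    rw [hzW]
    exact div_nonneg (sub_nonneg.2 hedges) hL2.le
  -- The clique sums of the lift need not equal z; the discrepancy enters as a square and so only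
  -- helps.
  have hWW : ∑ v, y v * (W (F v) - z (F v)) =
      ∑ r ∈ Finset.range α, (W r - z r) ^ 2 + ∑ r ∈ Finset.range α, z r * (W r - z r) := by
    rw [hfiber fun r => W r - z r, ← Finset.sum_add_distrib]
    exact Finset.sum_congr rfl fun r _ => by ring
  have hsq : 0 ≤ ∑ r ∈ Finset.range α, (W r - z r) ^ 2 :=
    Finset.sum_nonneg fun r _ => sq_nonneg _
  have hptle : ∀ v ∈ Finset.univ, y v * (W (F v) - z (F v)) ≤
      y v * (G.adjSum y v - (L - 1) * y v) :=
    fun v _ => mul_le_mul_of_nonneg_left (hpt v) (hypos v).le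
  have hptsum := Finset.sum_le_sum hptle
  have hexp : ∑ v, y v * (G.adjSum y v - (L - 1) * y v) =
      ∑ v, y v * G.adjSum y v - (L - 1) * ∑ v, y v ^ 2 := by
    rw [Finset.mul_sum, ← Finset.sum_sub_distrib]
    exact Finset.sum_congr rfl fun v _ => by ring
  have hV : Nonempty V := by
    by_contra h
    rw [not_nonempty_iff] at h
    have := T.card_rank 0 (by omega)
    simp at this
    omega
  have hray := sum_mul_adjSum_le G y
  have hy2 : 0 ≤ ∑ v, y v ^ 2 := Finset.sum_nonneg fun v _ => sq_nonneg _
  have hray2 := mul_le_mul_of_nonneg_right hle hy2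
  have hzero : ∑ v, y v * (G.adjSum y v - (L - 1) * y v) = 0 := by linarith
  have hsq0 : ∑ r ∈ Finset.range α, (W r - z r) ^ 2 = 0 := by linarith
  have hzW1 : ∑ r ∈ Finset.range α, z r * (W r - z r) = 0 := by linarith
  have hWz : ∀ r < α, W r = z r := by
    intro r hr
    have := (Finset.sum_eq_zero_iff_of_nonneg fun r _ => sq_nonneg _).1 hsq0 r
      (Finset.mem_range.2 hr)
    have := pow_eq_zero_iff (two_ne_zero) |>.1 this
    linarith
  have hpeq : ∀ v, W (F v) - z (F v) = G.adjSum y v - (L - 1) * y v := by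
    intro v
    have := (Finset.sum_eq_sum_iff_of_le hptle).1 (by linarith) v (Finset.mem_univ v)
    exact mul_left_cancel₀ (hypos v).ne' this
  have hadj : ∀ v, G.adjSum y v = W (F v) - y v + linkSum α a b y v := by
    intro v
    have h1 := (T.le_adjSum hypos v).1
    have h2 := (T.mul_cliqueLift_sub_linkSum_le hL hz v).1
    have h3 := hpeq v
    rw [← hy] at h2
    simp only [hW] at h3 ⊢
    linarith
  have hlink : ∀ v, L * y v - linkSum α a b y v = z (F v) := by
    intro v
    have h3 := hpeq v
    have h4 := hadj v
    linarith
  have hmin := fun v => (T.mul_cliqueLift_sub_linkSum_le hL hz v).2 (hlink v)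
  refine ⟨?_, fun v w => (T.le_adjSum hypos v).2 (hadj v) w, ?_, ?_⟩
  · refine T.parent_eq_sub_two hL hz hanti hstrict (κ := (1 - k / L) * (L ^ 2 - 1)) ?_ ?_
    · intro r hr
      have h1 := hWeq r hr
      rw [hWz r hr] at h1
      field_simp at h1 ⊢
      linarith
    · rw [hzW, div_eq_zero_iff] at hzW1
      have h1 := hzW1.resolve_right hL2.ne'
      have h2 := (Finset.sum_eq_sum_iff_of_le fun j hj => (hedge j hj).1).1 (by linarith)
      exact fun j hj => (hedge j hj).2 (h2 j hj).symm
  · intro i hi j hj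
    exact T.a_ne_b_of_cliqueLift_le hL hz hj hi ((hmin (b i) i hi).2 rfl)
  · intro i hi j hj
    exact T.b_injOn_of_cliqueLift_le hL hz hj hi ((hmin (a i) i hi).1 rfl)

end IsRankedCliqueTree

end Comparison

/-! ### Sorting the weights of the path from the centre outwards. -/

section ZigzagRearrangement

/-- The position on a path with `α` vertices of the vertex with the `j`-th largest weight: the
positions are enumerated from the centre outwards, alternating between the two sides. -/
def zigzag (α j : ℕ) : ℕ := if j % 2 = 0 then α / 2 + j / 2 else α / 2 - (j + 1) / 2

/-- The inverse of `zigzag`. -/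
def zigzagRank (α i : ℕ) : ℕ := if α / 2 ≤ i then 2 * (i - α / 2) else 2 * (α / 2 - i) - 1

theorem zigzag_lt {α j : ℕ} (h : j < α) : zigzag α j < α := by
  unfold zigzag; split_ifs <;> omega

theorem zigzagRank_lt {α i : ℕ} (h : i < α) : zigzagRank α i < α := by
  unfold zigzagRank; split_ifs <;> omega

theorem zigzagRank_zigzag {α j : ℕ} (h : j < α) : zigzagRank α (zigzag α j) = j := by
  unfold zigzag zigzagRank; split_ifs <;> omega

theorem zigzag_zigzagRank {α i : ℕ} (h : i < α) : zigzag α (zigzagRank α i) = i := by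
  unfold zigzag zigzagRank; split_ifs <;> omega

theorem sum_comp_zigzag (α : ℕ) (f : ℕ → ℝ) :
    ∑ j ∈ Finset.range α, f (zigzag α j) = ∑ i ∈ Finset.range α, f i :=
  Finset.sum_nbij' (zigzag α) (zigzagRank α)
    (fun _ hj => Finset.mem_range.2 (zigzag_lt (Finset.mem_range.1 hj)))
    (fun _ hi => Finset.mem_range.2 (zigzagRank_lt (Finset.mem_range.1 hi)))
    (fun _ hj => zigzagRank_zigzag (Finset.mem_range.1 hj))
    (fun _ hi => zigzag_zigzagRank (Finset.mem_range.1 hi)) (fun _ _ => rfl)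

theorem edgeForm_comm (L x y : ℝ) : edgeForm L x y = edgeForm L y x := by
  unfold edgeForm; ring

/-- Ranks j and j - 2 lie side by side on the same half of the path. For j = 1 truncated subtraction
gives rank 0, which is the link across the centre. -/
theorem sum_edgeForm_zigzag (L : ℝ) (m : ℕ) (s : ℕ → ℝ) :
    ∑ j ∈ Finset.Ico 1 (m + 1),
      edgeForm L (s (zigzag (m + 1) j)) (s (zigzag (m + 1) (j - 2))) =
      ∑ i ∈ Finset.range m, edgeForm L (s i) (s (i + 1)) := by
  refine Finset.sum_nbij'
    (fun j => if j % 2 = 0 then (m + 1) / 2 + j / 2 - 1 else (m + 1) / 2 - (j + 1) / 2)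
    (fun i => if (m + 1) / 2 ≤ i then 2 * (i + 1 - (m + 1) / 2)
      else 2 * ((m + 1) / 2 - i) - 1) ?_ ?_ ?_ ?_ ?_
  · intro j hj
    rw [Finset.mem_Ico] at hj
    rw [Finset.mem_range]
    split_ifs <;> omega
  · intro i hi
    rw [Finset.mem_range] at hi
    rw [Finset.mem_Ico]
    split_ifs <;> omega
  · intro j hj
    rw [Finset.mem_Ico] at hj
    split_ifs <;> omega
  · intro i hi
    rw [Finset.mem_range] at hi
    split_ifs <;> omega
  · intro j hj
    rw [Finset.mem_Ico] at hj
    by_cases h : j % 2 = 0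
    · rw [if_pos h, edgeForm_comm]
      congr 2
      · unfold zigzag; split_ifs <;> omega
      · unfold zigzag; split_ifs; omega
    · rw [if_neg h]
      congr 2
      · unfold zigzag; split_ifs; omega
      · unfold zigzag; split_ifs <;> omega

theorem sum_path_neighbors (m : ℕ) (f g : ℕ → ℝ) :
    ∑ i ∈ Finset.range (m + 1),
      ((if i + 1 < m + 1 then f i else 0) + (if 0 < i then g i else 0)) =
      ∑ i ∈ Finset.range m, (f i + g (i + 1)) := by
  rw [Finset.sum_add_distrib, Finset.sum_add_distrib]
  congr 1
  · rw [Finset.sum_range_succ, if_neg (lt_irrefl _), add_zero]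
    refine Finset.sum_congr rfl fun i hi => if_pos ?_
    have := Finset.mem_range.1 hi
    omega
  · rw [Finset.sum_range_succ', if_neg (lt_irrefl _), add_zero]
    exact Finset.sum_congr rfl fun i _ => if_pos (Nat.succ_pos _)

variable {L κ : ℝ} {m : ℕ} {s : ℕ → ℝ}

/-- The weights are strictly concave, as κ < 2 + 2/L, and symmetric, so they increase up to the
centre. -/
theorem pathEigenvector_lt (hL : 1 < L) (hs : ∀ i < m + 1, 0 < s i)
    (hsymm : ∀ i < m + 1, s (m - i) = s i)
    (heig : ∀ i < m + 1, κ * s i = (if i + 1 < m + 1 then linkWeight L (s i) (s (i + 1)) else 0) +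
      (if 0 < i then linkWeight L (s i) (s (i - 1)) else 0)) {i : ℕ} (hi : 2 * i + 1 < m) :
    s i < s (i + 1) := by
  have hL0 : 0 < 1 / L := by positivity
  have hκ : κ < 2 + 2 * (1 / L) := by
    -- Sum of all eigenvalue equations: each end vertex lacks one neighbour, which makes the bound
    -- on κ strict.
    have h1 : κ * ∑ i ∈ Finset.range (m + 1), s i =
        (1 + 1 / L) * (2 * (∑ i ∈ Finset.range (m + 1), s i) - s 0 - s m) := by
      rw [Finset.mul_sum, Finset.sum_congr rfl fun i hi => heig i (Finset.mem_range.1 hi),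
        sum_path_neighbors]
      have h2 : ∀ i ∈ Finset.range m, linkWeight L (s i) (s (i + 1)) +
          linkWeight L (s (i + 1)) (s (i + 1 - 1)) = (1 + 1 / L) * (s i + s (i + 1)) := by
        intro i _
        simp only [linkWeight, Nat.add_sub_cancel]
        ring
      rw [Finset.sum_congr rfl h2, ← Finset.mul_sum, Finset.sum_add_distrib]
      have h3 := Finset.sum_range_succ s m
      have h4 := Finset.sum_range_succ' s m
      congr 1
      linarith
    have h2 : 0 < ∑ i ∈ Finset.range (m + 1), s i :=
      Finset.sum_pos (fun i hi => hs i (Finset.mem_range.1 hi)) ⟨0, by simp⟩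
    have h3 := hs 0 (by omega)
    have h4 := hs m (by omega)
    by_contra hc
    push Not at hc
    have h5 := mul_le_mul_of_nonneg_right hc h2.le
    rw [h1] at h5
    have h6 : 0 < (1 + 1 / L) * (s 0 + s m) := by positivity
    linarith
  have hconc : ∀ i, 0 < i → i < m → s (i + 1) - s i < s i - s (i - 1) := by
    intro i h0 him
    have h1 := heig i (by omega)
    rw [if_pos (by omega), if_pos h0] at h1
    have h2 := mul_lt_mul_of_pos_right hκ (hs i (by omega))
    have h3 : s i / L = 1 / L * s i := by ring
    unfold linkWeight at h1
    linarith
  have hdec : ∀ d i, i + (d + 1) < m →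
      s (i + (d + 1) + 1) - s (i + (d + 1)) < s (i + 1) - s i := by
    intro d
    induction d with
    | zero => intro i hi; exact hconc (i + 1) (by omega) (by omega)
    | succ d ih =>
      intro i hi
      have h1 := hconc (i + (d + 1 + 1)) (by omega) (by omega)
      have h2 := ih i (by omega)
      exact h1.trans h2
  -- The increment at `i` exceeds the one at its mirror image m - (i + 1), which by symmetry is its
  -- negative; so it is positive.
  have h1 := hdec (m - 1 - i - i - 1) i (by omega)
  have e1 : i + (m - 1 - i - i - 1 + 1) = m - (i + 1) := by omega
  have e2 : m - (i + 1) + 1 = m - i := by omega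
  rw [e1, e2, hsymm i (by omega), hsymm (i + 1) (by omega)] at h1
  linarith

theorem exists_zigzag_eigenvector (hL : 1 < L) (hs : ∀ i < m + 1, 0 < s i)
    (hsymm : ∀ i < m + 1, s (m - i) = s i)
    (heig : ∀ i < m + 1, κ * s i = (if i + 1 < m + 1 then linkWeight L (s i) (s (i + 1)) else 0) +
      (if 0 < i then linkWeight L (s i) (s (i - 1)) else 0)) :
    ∃ z : ℕ → ℝ, (∀ r < m + 1, 0 < z r) ∧ (∀ i j, i ≤ j → j < m + 1 → z j ≤ z i) ∧
      (∀ j, j + 2 < m + 1 → z (j + 2) < z j) ∧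
      ∑ j ∈ Finset.Ico 1 (m + 1), edgeForm L (z j) (z (j - 2)) =
        κ * ∑ r ∈ Finset.range (m + 1), z r ^ 2 := by
  have hlt : ∀ i, 2 * i + 1 < m → s i < s (i + 1) := fun i hi =>
    pathEigenvector_lt hL hs hsymm heig hi
  have hgt : ∀ i, i < m → m < 2 * i + 1 → s (i + 1) < s i := by
    intro i him hi
    have := hlt (m - (i + 1)) (by omega)
    have e : m - (i + 1) + 1 = m - i := by omega
    rwa [e, hsymm i (by omega), hsymm (i + 1) (by omega)] at this
  have hstrict : ∀ j, j + 2 < m + 1 → s (zigzag (m + 1) (j + 2)) < s (zigzag (m + 1) j) := by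
    intro j hj
    by_cases h : j % 2 = 0
    · have e : zigzag (m + 1) (j + 2) = zigzag (m + 1) j + 1 := by
        unfold zigzag; split_ifs <;> omega
      rw [e]
      refine hgt _ ?_ ?_ <;> (unfold zigzag; split_ifs; omega)
    · have e : zigzag (m + 1) j = zigzag (m + 1) (j + 2) + 1 := by
        unfold zigzag; split_ifs <;> omega
      rw [e]
      refine hlt _ ?_
      unfold zigzag; split_ifs <;> omega
  have hstep : ∀ j, j + 1 < m + 1 → s (zigzag (m + 1) (j + 1)) ≤ s (zigzag (m + 1) j) := by
    intro j hj
    have hz := zigzag_lt hj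
    -- Consecutive ranks lie on opposite sides. Reflected, the position of rank j + 1 is either that
    -- of rank j or the next one outwards, depending on the parities of m and j.
    rw [← hsymm _ hz]
    by_cases h : m - zigzag (m + 1) (j + 1) = zigzag (m + 1) j
    · rw [h]
    · by_cases h2 : j % 2 = 0
      · have e : m - zigzag (m + 1) (j + 1) = zigzag (m + 1) j + 1 := by
          unfold zigzag at h ⊢; split_ifs at h ⊢ <;> omega
        rw [e]
        refine (hgt _ ?_ ?_).le <;> (unfold zigzag at h ⊢; split_ifs at h ⊢ <;> omega)
      · have e : m - zigzag (m + 1) (j + 1) + 1 = zigzag (m + 1) j := by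
          unfold zigzag at h ⊢; split_ifs at h ⊢ <;> omega
        rw [← e]
        refine (hlt _ ?_).le
        unfold zigzag at h ⊢; split_ifs at h ⊢ <;> omega
  refine ⟨fun j => s (zigzag (m + 1) j), fun r hr => hs _ (zigzag_lt hr), ?_, hstrict, ?_⟩
  · intro i j hij
    induction j, hij using Nat.le_induction with
    | base => exact fun _ => le_rfl
    | succ j _ ih => exact fun hj => (hstep j hj).trans (ih (by omega))
  · rw [sum_edgeForm_zigzag, sum_comp_zigzag (m + 1) fun i => s i ^ 2, Finset.mul_sum]
    have h1 : ∀ i ∈ Finset.range (m + 1), κ * s i ^ 2 =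
        ((if i + 1 < m + 1 then s i * linkWeight L (s i) (s (i + 1)) else 0) +
          (if 0 < i then s i * linkWeight L (s i) (s (i - 1)) else 0)) := by
      intro i hi
      have := heig i (Finset.mem_range.1 hi)
      calc κ * s i ^ 2 = s i * (κ * s i) := by ring
        _ = _ := by rw [this, mul_add, mul_ite, mul_ite, mul_zero]
    rw [Finset.sum_congr rfl h1, sum_path_neighbors m
      (fun i => s i * linkWeight L (s i) (s (i + 1)))
      (fun i => s i * linkWeight L (s i) (s (i - 1)))]
    rfl

end ZigzagRearrangement

/-! ### The clique path: membership, bounds and Perron vector. -/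

section CliquePath

variable {k α : ℕ}

theorem cliquePath_adj {p q : Fin α × Fin k} : (cliquePath k α).Adj p q ↔ p ≠ q ∧
    (p.1 = q.1 ∨ (p.1.val + 1 = q.1.val ∧ p.2.val + 1 = k ∧ q.2.val = 0) ∨
      (q.1.val + 1 = p.1.val ∧ q.2.val + 1 = k ∧ p.2.val = 0)) := by
  rw [cliquePath, SimpleGraph.fromRel_adj]
  constructor
  · rintro ⟨h, (h1 | h1) | (h1 | h1)⟩
    · exact ⟨h, Or.inl h1⟩
    · exact ⟨h, Or.inr (Or.inl h1)⟩
    · exact ⟨h, Or.inl h1.symm⟩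
    · exact ⟨h, Or.inr (Or.inr h1)⟩
  · rintro ⟨h, h1 | h1 | h1⟩
    · exact ⟨h, Or.inl (Or.inl h1)⟩
    · exact ⟨h, Or.inl (Or.inr h1)⟩
    · exact ⟨h, Or.inr (Or.inr h1)⟩

theorem cliquePath_connected (hα : 1 ≤ α) (hk : 1 ≤ k) : (cliquePath k α).Connected := by
  have hsame : ∀ (i : Fin α) (c d : Fin k), (cliquePath k α).Reachable (i, c) (i, d) := by
    intro i c d
    by_cases h : c = d
    · rw [h]
    · exact (cliquePath_adj.2 ⟨by simpa using h, Or.inl rfl⟩ :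
        (cliquePath k α).Adj (i, c) (i, d)).reachable
  have hbase : ∀ (n : ℕ) (hn : n < α) (c : Fin k),
      (cliquePath k α).Reachable (⟨n, hn⟩, c) (⟨0, hα⟩, c) := by
    intro n
    induction n with
    | zero => exact fun _ c => hsame _ c c
    | succ n ih =>
      intro hn c
      have hadj : (cliquePath k α).Adj (⟨n + 1, hn⟩, ⟨0, hk⟩) (⟨n, by omega⟩, ⟨k - 1, by omega⟩) :=
        cliquePath_adj.2 ⟨by simp, Or.inr (Or.inr ⟨rfl, by simp; omega, rfl⟩)⟩
      exact (hsame _ c _).trans (hadj.reachable.trans ((hsame _ _ c).trans (ih (by omega) c)))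
  have : Nonempty (Fin α × Fin k) := ⟨(⟨0, hα⟩, ⟨0, hk⟩)⟩
  exact SimpleGraph.Connected.mk fun u v =>
    (hbase u.1.1 u.1.2 u.2).trans ((hsame _ u.2 v.2).trans (hbase v.1.1 v.1.2 v.2).symm)

theorem cliquePath_indepNum (hk : 2 ≤ k) : (cliquePath k α).indepNum = α := by
  classical
  apply le_antisymm
  · obtain ⟨s, hs⟩ := (cliquePath k α).exists_isNIndepSet_indepNum
    rw [← hs.card_eq]
    refine le_trans (b := #(Finset.univ : Finset (Fin α))) ?_ (by simp)
    refine Finset.card_le_card_of_injOn Prod.fst (fun _ _ => Finset.mem_coe.2 (Finset.mem_univ _)) ?_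
    intro p hp q hq hpq
    by_contra hne
    exact hs.isIndepSet hp hq hne (cliquePath_adj.2 ⟨hne, Or.inl hpq⟩)
  · have hs : (cliquePath k α).IsIndepSet
        ((Finset.univ.image fun i : Fin α => (i, (⟨0, by omega⟩ : Fin k)) : Finset _) :
          Set (Fin α × Fin k)) := by
      intro p hp q hq hne hadj
      obtain ⟨i, -, rfl⟩ := Finset.mem_image.1 (Finset.mem_coe.1 hp)
      obtain ⟨j, -, rfl⟩ := Finset.mem_image.1 (Finset.mem_coe.1 hq)
      rcases (cliquePath_adj.1 hadj).2 with h | h | h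
      · exact hne (Prod.ext h rfl)
      · simp at h; omega
      · simp at h; omega
    have := hs.card_le_indepNum
    rwa [Finset.card_image_of_injective, Finset.card_univ, Fintype.card_fin] at this
    intro i j hij
    exact congrArg Prod.fst hij

theorem cliquePath_isConnectedOfOrderIndep (hα : 1 ≤ α) (hk : 2 ≤ k) :
    IsConnectedOfOrderIndep (k * α) α (cliquePath k α) where
  order_eq := by simp [mul_comm]
  connected := cliquePath_connected hα (by omega)
  indepNum_eq := cliquePath_indepNum hk

theorem sum_cliquePath (f : ℕ → ℕ → ℝ) : ∑ q : Fin α × Fin k, f q.1.val q.2.val =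
    ∑ i ∈ Finset.range α, ∑ c ∈ Finset.range k, f i c := by
  rw [Fintype.sum_prod_type, Finset.sum_range]
  exact Finset.sum_congr rfl fun i _ => (Finset.sum_range (f i)).symm

theorem adjSum_cliquePath (hk : 2 ≤ k) (Y : ℕ → ℕ → ℝ) (i : Fin α) (c : Fin k) :
    (cliquePath k α).adjSum (fun q => Y q.1.val q.2.val) (i, c) =
      (∑ d ∈ Finset.range k, Y i d) - Y i c +
        (if i.val + 1 < α ∧ c.val + 1 = k then Y (i + 1) 0 else 0) +
        (if 0 < i.val ∧ c.val = 0 then Y (i - 1) (k - 1) else 0) := by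
  classical
  -- A row of the adjacency matrix: own clique, minus the vertex itself, plus the link to the next
  -- clique and the link to the previous one.
  obtain ⟨f, hf⟩ : ∃ f : ℕ → ℕ → ℝ, f = fun j d : ℕ => (if j = i.val then Y j d else 0) -
        (if j = i.val then if d = c.val then Y j d else 0 else 0) +
        (if c.val + 1 = k then if j = i.val + 1 then if d = 0 then Y j d else 0 else 0 else 0) +
        (if 0 < i.val ∧ c.val = 0 then if j = i.val - 1 then if d = k - 1 then Y j d else 0 else 0
          else 0) := ⟨_, rfl⟩
  have hentry : ∀ q : Fin α × Fin k,
      (if (cliquePath k α).Adj (i, c) q then Y q.1.val q.2.val else 0) =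
      f q.1.val q.2.val := by
    rintro ⟨j, d⟩
    simp only [hf, cliquePath_adj, ne_eq, Prod.mk.injEq, Fin.ext_iff, not_and]
    have hi := i.2
    have hj := j.2
    have hc := c.2
    have hd := d.2
    split_ifs <;> first | (exfalso; omega) | simp
  have hsum : (cliquePath k α).adjSum (fun q => Y q.1.val q.2.val) (i, c) =
      ∑ q : Fin α × Fin k,
        (if (cliquePath k α).Adj (i, c) q then Y q.1.val q.2.val else 0) := by
    unfold SimpleGraph.adjSum
    rfl
  rw [hsum, Finset.sum_congr rfl fun q _ => hentry q, sum_cliquePath]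
  simp only [hf, Finset.sum_add_distrib, Finset.sum_sub_distrib]
  congr 1
  · congr 1
    · congr 1
      · rw [Finset.sum_eq_single_of_mem i.val (Finset.mem_range.2 i.2)]
        · simp
        · intro j _ hj
          simp [hj]
      · rw [Finset.sum_eq_single_of_mem i.val (Finset.mem_range.2 i.2)]
        · simp
        · intro j _ hj
          simp [hj]
    · by_cases h : c.val + 1 = k
      · have hk0 : 0 < k := by omega
        simp only [h, if_true, and_true]
        by_cases h2 : i.val + 1 < α
        · rw [Finset.sum_eq_single_of_mem (i.val + 1) (Finset.mem_range.2 h2)]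
          · simp [h2, hk0]
          · intro j _ hj
            simp [hj]
        · rw [if_neg h2]
          refine Finset.sum_eq_zero fun j hj => ?_
          have : j ≠ i.val + 1 := by
            have := Finset.mem_range.1 hj; omega
          simp [this]
      · simp [h]
  · by_cases h : 0 < i.val ∧ c.val = 0
    · have hk0 : 0 < k := by omega
      simp only [h, and_true, if_true]
      rw [Finset.sum_eq_single_of_mem (i.val - 1) (Finset.mem_range.2 (by omega))]
      · simp [hk0]
      · intro j _ hj
        simp [hj]
    · simp [h]

/-- Test vector: 1 at inner vertices and 1 + t at the two port vertices of each clique, t = 1/(k -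
1). Inner rows are equalities for k - 1 + 2t, while a linked port needs k + 2t ≤ (k - 1 + 2t)(1 + t)
= k + 2t + 2t². -/
theorem cliquePath_spectralRadius_le (hα : 1 ≤ α) (hk : 2 ≤ k) :
    graphSpectralRadius (cliquePath k α) ≤ k - 1 + 2 / ((k : ℝ) - 1) := by
  have : Nonempty (Fin α × Fin k) := ⟨(⟨0, hα⟩, ⟨0, by omega⟩)⟩
  have hk1 : (1 : ℝ) ≤ k - 1 := by
    have : (2 : ℝ) ≤ k := by exact_mod_cast hk
    linarith
  set t : ℝ := 1 / ((k : ℝ) - 1) with ht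
  have ht0 : 0 < t := by positivity
  have htk : t * ((k : ℝ) - 1) = 1 := by rw [ht]; field_simp
  set Y : ℕ → ℕ → ℝ := fun _ c => 1 + ((if c = 0 then t else 0) + (if c = k - 1 then t else 0))
    with hY
  have hY0 : ∀ i, Y i 0 = 1 + t := fun i => by
    simp only [hY, if_true]; rw [if_neg (by omega)]; ring
  have hYk : ∀ i, Y i (k - 1) = 1 + t := fun i => by
    simp only [hY, if_true]; rw [if_neg (by omega)]; ring
  have hYsum : ∀ i, ∑ d ∈ Finset.range k, Y i d = k + 2 * t := by
    intro i
    simp only [hY, Finset.sum_add_distrib, Finset.sum_ite_eq', Finset.mem_range, Finset.sum_const,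
      Finset.card_range, nsmul_eq_mul]
    rw [if_pos (by omega), if_pos (by omega)]
    ring
  have hμ : (k : ℝ) - 1 + 2 / ((k : ℝ) - 1) = k - 1 + 2 * t := by rw [ht]; ring
  rw [hμ]
  clear_value Y
  refine spectralRadius_le_of_adjSum_le _ (x := fun q => Y q.1.val q.2.val) ?_ ?_
  · rintro ⟨i, c⟩
    simp only [hY]
    split_ifs <;> linarith
  · rintro ⟨i, c⟩
    rw [adjSum_cliquePath hk, hYsum, hY0, hYk]
    simp only
    by_cases h0 : c.val = 0
    · rw [if_neg (by omega), h0, hY0]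
      split_ifs <;> nlinarith
    · by_cases h1 : c.val = k - 1
      · rw [if_neg (by omega : ¬ (0 < i.val ∧ c.val = 0)), h1, hYk]
        split_ifs <;> nlinarith
      · have : Y i c = 1 := by simp [hY, h0, h1]
        rw [if_neg (by omega), if_neg (by omega), this]
        linarith

theorem le_cliquePath_spectralRadius (hα : 1 ≤ α) (hk : 1 ≤ k) :
    (k : ℝ) - 1 ≤ graphSpectralRadius (cliquePath k α) := by
  classical
  have h := card_sub_one_le_spectralRadius (cliquePath k α)
    (s := Finset.univ.image fun c : Fin k => ((⟨0, hα⟩ : Fin α), c))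
    ⟨(⟨0, hα⟩, ⟨0, hk⟩), by simp⟩ (by
      intro p hp q hq hne
      obtain ⟨c, -, rfl⟩ := Finset.mem_image.1 hp
      obtain ⟨d, -, rfl⟩ := Finset.mem_image.1 hq
      exact cliquePath_adj.2 ⟨hne, Or.inl rfl⟩)
  rwa [Finset.card_image_of_injective, Finset.card_univ, Fintype.card_fin] at h
  intro c d hcd
  exact congrArg Prod.snd hcd

/-- The rotation of the clique path that reverses the order of the cliques. -/
def cliquePathRev (k α : ℕ) : cliquePath k α ≃g cliquePath k α where
  toEquiv := Equiv.prodCongr Fin.revPerm Fin.revPerm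
  map_rel_iff' := by
    rintro ⟨i, c⟩ ⟨j, d⟩
    simp only [cliquePath_adj, ne_eq, Prod.mk.injEq, Equiv.prodCongr_apply, Prod.map_apply,
      Fin.revPerm_apply, Fin.rev_inj, Fin.val_rev]
    have hi := i.2
    have hj := j.2
    have hc := c.2
    have hd := d.2
    refine and_congr_right fun _ => or_congr_right ?_
    omega

/-- A Perron vector plus its image under `cliquePathRev` is again a positive eigenvector, now
symmetric. -/
theorem exists_symm_eigenvector (hα : 1 ≤ α) (hk : 1 ≤ k) :
    ∃ Y : ℕ → ℕ → ℝ, (∀ i c, i < α → c < k → 0 < Y i c) ∧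
      (∀ i c, i < α → c < k → Y (α - 1 - i) (k - 1 - c) = Y i c) ∧
      ∀ q : Fin α × Fin k, (cliquePath k α).adjSum (fun q => Y q.1.val q.2.val) q =
        graphSpectralRadius (cliquePath k α) * Y q.1.val q.2.val := by
  classical
  obtain ⟨x, hx, heig⟩ := exists_pos_eigenvector _ (cliquePath_connected hα hk)
  set x' : Fin α × Fin k → ℝ := fun q => x q + x (cliquePathRev k α q) with hx'
  have heig' : ∀ q, (cliquePath k α).adjSum x' q =
      graphSpectralRadius (cliquePath k α) * x' q := by
    intro q
    have h1 : (cliquePath k α).adjSum x' q = (cliquePath k α).adjSum x q +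
        (cliquePath k α).adjSum (fun q => x (cliquePathRev k α q)) q := by
      simp only [SimpleGraph.adjSum, hx', ← Finset.sum_add_distrib]
      exact Finset.sum_congr rfl fun w _ => by split_ifs <;> simp
    rw [h1, adjSum_iso, heig, heig, hx']
    ring
  have hY : ∀ q : Fin α × Fin k, (fun i c : ℕ => if h : i < α ∧ c < k then
      x' (⟨i, h.1⟩, ⟨c, h.2⟩) else 0) q.1.val q.2.val = x' q := by
    rintro ⟨i, c⟩
    simp
  refine ⟨fun i c => if h : i < α ∧ c < k then x' (⟨i, h.1⟩, ⟨c, h.2⟩) else 0, ?_, ?_, ?_⟩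
  · intro i c hi hc
    simp only [hi, hc, and_self, dif_pos, hx']
    exact add_pos (hx _) (hx _)
  · intro i c hi hc
    have h1 : α - 1 - i < α := by omega
    have h2 : k - 1 - c < k := by omega
    simp only [hi, hc, h1, h2, and_self, dif_pos, hx']
    have e1 : cliquePathRev k α (⟨i, hi⟩, ⟨c, hc⟩) = (⟨α - 1 - i, h1⟩, ⟨k - 1 - c, h2⟩) := by
      refine Prod.ext (Fin.ext ?_) (Fin.ext ?_) <;> simp [cliquePathRev] <;> omega
    have e2 : cliquePathRev k α (⟨α - 1 - i, h1⟩, ⟨k - 1 - c, h2⟩) = (⟨i, hi⟩, ⟨c, hc⟩) := by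
      refine Prod.ext (Fin.ext ?_) (Fin.ext ?_) <;> simp [cliquePathRev] <;> omega
    rw [e1, e2, add_comm]
  · intro q
    simp only [hY]
    exact heig' q

/-- `s` consists of the clique sums of the symmetric eigenvector. Solving the equations at the two
ends of each link expresses the port entries through these sums and leaves an eigenvalue problem on
a path with α vertices. -/
theorem exists_pathEigenvector (hα : 1 ≤ α) (hk : 2 ≤ k) {L : ℝ}
    (hL : L = graphSpectralRadius (cliquePath k α) + 1) :
    ∃ s : ℕ → ℝ, (∀ i < α, 0 < s i) ∧ (∀ i < α, s (α - 1 - i) = s i) ∧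
      ∀ i < α, (1 - k / L) * (L ^ 2 - 1) * s i =
        (if i + 1 < α then linkWeight L (s i) (s (i + 1)) else 0) +
        (if 0 < i then linkWeight L (s i) (s (i - 1)) else 0) := by
  obtain ⟨Y, hpos, hsymm, heig⟩ := exists_symm_eigenvector hα (by omega : 1 ≤ k)
  have hL0 : L ≠ 0 := by
    have h1 := le_cliquePath_spectralRadius hα (by omega : 1 ≤ k)
    have h2 : (2 : ℝ) ≤ k := by exact_mod_cast hk
    linarith
  have hk0 : 0 < k := by omega
  set S : ℕ → ℝ := fun i => ∑ c ∈ Finset.range k, Y i c with hS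
  have hrec : ∀ i < α, ∀ c < k, L * Y i c = S i +
      (if c = k - 1 then if i + 1 < α then Y (i + 1) 0 else 0 else 0) +
      (if c = 0 then if 0 < i then Y (i - 1) (k - 1) else 0 else 0) := by
    intro i hi c hc
    have h1 := heig (⟨i, hi⟩, ⟨c, hc⟩)
    rw [adjSum_cliquePath hk] at h1
    simp only at h1
    have e1 : (if i + 1 < α ∧ c + 1 = k then Y (i + 1) 0 else 0) =
        (if c = k - 1 then if i + 1 < α then Y (i + 1) 0 else 0 else 0) := by
      split_ifs <;> first | rfl | (exfalso; omega)
    have e2 : (if 0 < i ∧ c = 0 then Y (i - 1) (k - 1) else 0) =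
        (if c = 0 then if 0 < i then Y (i - 1) (k - 1) else 0 else 0) := by
      split_ifs <;> first | rfl | (exfalso; omega)
    rw [e1, e2] at h1
    rw [hL]
    linarith
  have hA : ∀ i, i + 1 < α → (L ^ 2 - 1) * Y (i + 1) 0 = L * linkWeight L (S i) (S (i + 1)) ∧
      (L ^ 2 - 1) * Y i (k - 1) = L * linkWeight L (S (i + 1)) (S i) := by
    intro i hi
    have h1 := hrec i (by omega) (k - 1) (by omega)
    have h2 := hrec (i + 1) hi 0 hk0
    rw [if_pos rfl, if_pos hi, if_neg (by omega)] at h1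
    rw [if_neg (by omega), if_pos rfl, if_pos (by omega), Nat.add_sub_cancel] at h2
    unfold linkWeight
    rw [mul_add, mul_add, mul_div_cancel₀ _ hL0, mul_div_cancel₀ _ hL0]
    constructor
    · linear_combination L * h2 + h1
    · linear_combination L * h1 + h2
  refine ⟨S, fun i hi => Finset.sum_pos (fun c hc => hpos i c hi (Finset.mem_range.1 hc))
    ⟨0, by simpa using hk0⟩, fun i hi => ?_, fun i hi => ?_⟩
  · simp only [hS]
    rw [← Finset.sum_range_reflect]
    refine Finset.sum_congr rfl fun c hc => ?_
    exact hsymm i c hi (Finset.mem_range.1 hc)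
  · have h1 : L * S i = k * S i + (if i + 1 < α then Y (i + 1) 0 else 0) +
        (if 0 < i then Y (i - 1) (k - 1) else 0) := by
      simp only [hS]
      rw [Finset.mul_sum, Finset.sum_congr rfl fun c hc => hrec i hi c (Finset.mem_range.1 hc),
        Finset.sum_add_distrib, Finset.sum_add_distrib]
      simp only [Finset.sum_ite_eq', Finset.mem_range, Finset.sum_const, Finset.card_range,
        nsmul_eq_mul, hk0, if_true]
      rw [if_pos (by omega)]
    have h2 : (1 - k / L) * (L ^ 2 - 1) * S i = (L ^ 2 - 1) * (L * S i - k * S i) / L := by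
      field_simp
    rw [h2, h1]
    have h3 : (L ^ 2 - 1) * (if i + 1 < α then Y (i + 1) 0 else 0) =
        L * (if i + 1 < α then linkWeight L (S i) (S (i + 1)) else 0) := by
      split_ifs with h
      · exact (hA i h).1
      · simp
    have h4 : (L ^ 2 - 1) * (if 0 < i then Y (i - 1) (k - 1) else 0) =
        L * (if 0 < i then linkWeight L (S i) (S (i - 1)) else 0) := by
      split_ifs with h
      · have := (hA (i - 1) (by omega)).2
        rwa [Nat.sub_add_cancel h] at this
      · simp
    rw [div_eq_iff hL0]
    linear_combination h3 + h4

end CliquePath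

/-! ### Recognising the clique path. -/

section Isomorphism

theorem exists_equiv_fin_of_ne {A : Type*} [Fintype A] {k : ℕ} (hA : Fintype.card A = k) {x y : A}
    (hxy : x ≠ y) {u w : Fin k} (huw : u ≠ w) : ∃ g : A ≃ Fin k, g x = u ∧ g y = w := by
  classical
  let e₀ := Fintype.equivFinOfCardEq hA
  let e₁ := e₀.trans (Equiv.swap (e₀ x) u)
  have hx : e₁ x = u := by simp [e₁]
  have hy : e₁ y ≠ u := fun h => hxy (e₁.injective (hx.trans h.symm))
  refine ⟨e₁.trans (Equiv.swap (e₁ y) w), ?_, by simp⟩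
  rw [Equiv.trans_apply, hx, Equiv.swap_apply_of_ne_of_ne hy.symm huw]

/-- A graph that is made up of `α` cliques of order `k` and of disjoint edges joining consecutive
cliques is isomorphic to the clique path. -/
theorem nonempty_iso_cliquePath {V : Type*} [Fintype V] {G : SimpleGraph V} {k α : ℕ}
    (hk : 2 ≤ k) (q : V → Fin α) (hcard : ∀ i, Nat.card {v // q v = i} = k)
    (hsame : ∀ u v, u ≠ v → q u = q v → G.Adj u v) (R L : ℕ → V)
    (hR : ∀ i, i + 1 < α → (q (R i)).val = i) (hL : ∀ i, i + 1 < α → (q (L (i + 1))).val = i + 1)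
    (hRL : ∀ i, i + 1 < α → G.Adj (R i) (L (i + 1)))
    (hcross : ∀ v w, G.Adj v w → q v ≠ q w → ∃ i, i + 1 < α ∧
      ((v = R i ∧ w = L (i + 1)) ∨ (v = L (i + 1) ∧ w = R i)))
    (hne : ∀ i, 0 < i → i + 1 < α → R i ≠ L i) : Nonempty (G ≃g cliquePath k α) := by
  classical
  have hlr : ∀ i : Fin α, ∃ l r : {v // q v = i}, l ≠ r ∧ (0 < i.val → l.1 = L i) ∧
      (i.val + 1 < α → r.1 = R i) := by
    -- Each clique gets two distinct ports. An end clique lacks a prescribed one, and any other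
    -- vertex serves since k ≥ 2.
    intro i
    have hnt : ∀ x : {v // q v = i}, ∃ y, y ≠ x := by
      have : Nontrivial {v // q v = i} := by
        rw [← Fintype.one_lt_card_iff_nontrivial, ← Nat.card_eq_fintype_card, hcard]
        omega
      exact exists_ne
    have hne' : Nonempty {v // q v = i} := by
      rw [← Fintype.card_pos_iff, ← Nat.card_eq_fintype_card, hcard]
      omega
    have hRi : i.val + 1 < α → q (R i) = i := fun h => Fin.ext (hR i h)
    have hLi : 0 < i.val → q (L i) = i := fun h => Fin.ext (by
      have := hL (i.val - 1) (by omega)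
      rwa [Nat.sub_add_cancel h] at this)
    by_cases h0 : 0 < i.val
    · by_cases h1 : i.val + 1 < α
      · exact ⟨⟨L i, hLi h0⟩, ⟨R i, hRi h1⟩, fun h => hne i h0 h1 (congrArg Subtype.val h).symm,
          fun _ => rfl, fun _ => rfl⟩
      · obtain ⟨y, hy⟩ := hnt ⟨L i, hLi h0⟩
        exact ⟨_, y, hy.symm, fun _ => rfl, fun h => absurd h h1⟩
    · by_cases h1 : i.val + 1 < α
      · obtain ⟨y, hy⟩ := hnt ⟨R i, hRi h1⟩
        exact ⟨y, _, hy, fun h => absurd h h0, fun _ => rfl⟩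
      · obtain ⟨x⟩ := hne'
        obtain ⟨y, hy⟩ := hnt x
        exact ⟨y, x, hy, fun h => absurd h h0, fun h => absurd h h1⟩
  choose l r hlr hl hr using hlr
  have hg : ∀ i : Fin α, ∃ g : {v // q v = i} ≃ Fin k,
      g (l i) = ⟨0, by omega⟩ ∧ g (r i) = ⟨k - 1, by omega⟩ := fun i =>
    exists_equiv_fin_of_ne (by rw [← Nat.card_eq_fintype_card, hcard]) (hlr i) (by
      intro h
      have := congrArg Fin.val h
      simp at this
      omega)
  choose g hgl hgr using hg
  let e : V ≃ Fin α × Fin k :=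
    (Equiv.sigmaFiberEquiv q).symm.trans
      ((Equiv.sigmaCongrRight g).trans (Equiv.sigmaEquivProd (Fin α) (Fin k)))
  have he : ∀ (i : Fin α) (x : {v // q v = i}), e x.1 = (i, g i x) := by
    rintro _ ⟨v, rfl⟩
    rfl
  have heR : ∀ i, i + 1 < α → (e (R i)).1.val = i ∧ (e (R i)).2.val + 1 = k := by
    intro i hi
    have h1 : q (R i) = ⟨i, by omega⟩ := Fin.ext (hR i hi)
    have h2 : (⟨R i, h1⟩ : {v // q v = ⟨i, _⟩}) = r ⟨i, by omega⟩ :=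
      Subtype.ext (hr ⟨i, by omega⟩ hi).symm
    have h3 : e (R i) = (⟨i, by omega⟩, ⟨k - 1, by omega⟩) := by
      rw [← hgr, ← h2]
      exact he _ ⟨R i, h1⟩
    rw [h3]
    exact ⟨rfl, by simp; omega⟩
  have heL : ∀ i, i + 1 < α → (e (L (i + 1))).1.val = i + 1 ∧ (e (L (i + 1))).2.val = 0 := by
    intro i hi
    have h1 : q (L (i + 1)) = ⟨i + 1, hi⟩ := Fin.ext (hL i hi)
    have h2 : (⟨L (i + 1), h1⟩ : {v // q v = ⟨i + 1, _⟩}) = l ⟨i + 1, hi⟩ :=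
      Subtype.ext (hl ⟨i + 1, hi⟩ (by simp)).symm
    have h3 : e (L (i + 1)) = (⟨i + 1, hi⟩, ⟨0, by omega⟩) := by
      rw [← hgl, ← h2]
      exact he _ ⟨L (i + 1), h1⟩
    rw [h3]
    exact ⟨rfl, rfl⟩
  have hforward : ∀ v w, (e v).1.val + 1 = (e w).1.val → (e v).2.val + 1 = k →
      (e w).2.val = 0 → G.Adj v w := by
    intro v w h1 h2 h3
    have hi : (e v).1.val + 1 < α := h1 ▸ (e w).1.2
    have hv : v = R (e v).1.val := by
      have := heR _ hi
      refine e.injective (Prod.ext (Fin.ext this.1.symm) (Fin.ext ?_))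
      omega
    have hw : w = L ((e v).1.val + 1) := by
      have := heL _ hi
      refine e.injective (Prod.ext (Fin.ext ?_) (Fin.ext ?_)) <;> omega
    rw [hw]
    nth_rewrite 1 [hv]
    exact hRL _ hi
  refine ⟨⟨e, ?_⟩⟩
  intro v w
  rw [cliquePath_adj]
  constructor
  · rintro ⟨h, h1 | h1 | h1⟩
    · exact hsame v w (fun h2 => h (by rw [h2])) h1
    · exact hforward v w h1.1 h1.2.1 h1.2.2
    · exact (hforward w v h1.1 h1.2.1 h1.2.2).symm
  · intro hadj
    refine ⟨fun h => hadj.ne (e.injective h), ?_⟩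
    by_cases hq : q v = q w
    · exact Or.inl hq
    · obtain ⟨i, hi, ⟨rfl, rfl⟩ | ⟨rfl, rfl⟩⟩ := hcross v w hadj hq
      · have h1 := heR i hi
        have h2 := heL i hi
        exact Or.inr (Or.inl (by omega))
      · have h1 := heR i hi
        have h2 := heL i hi
        exact Or.inr (Or.inr (by omega))

/-- A ranked clique tree in which the parent of the clique of rank `j` has rank `j - 2` and whose
links are disjoint is isomorphic to the clique path. -/
theorem IsRankedCliqueTree.nonempty_iso {V : Type*} [Fintype V] {G : SimpleGraph V} {k α : ℕ}
    {F : V → ℕ} {p : ℕ → ℕ} {a b : ℕ → V} (T : IsRankedCliqueTree G k α F p a b) (hk : 2 ≤ k)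
    (hp : ∀ j ∈ Finset.Ico 1 α, p j = j - 2)
    (hcross : ∀ v w, G.Adj v w → F v ≠ F w →
      ∃ j ∈ Finset.Ico 1 α, (v = a j ∧ w = b j) ∨ (v = b j ∧ w = a j))
    (hab : ∀ i ∈ Finset.Ico 1 α, ∀ j ∈ Finset.Ico 1 α, a i ≠ b j)
    (hbb : ∀ i ∈ Finset.Ico 1 α, ∀ j ∈ Finset.Ico 1 α, b i = b j → i = j) :
    Nonempty (G ≃g cliquePath k α) := by
  classical
  have haa : ∀ i ∈ Finset.Ico 1 α, ∀ j ∈ Finset.Ico 1 α, a i = a j → i = j :=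
    fun i hi j hj h => by rw [← T.rank_a i hi, ← T.rank_a j hj, h]
  -- `idx i` is the rank of the link between the cliques at the positions `i` and `i + 1`
  obtain ⟨idx, hidx⟩ : ∃ idx : ℕ → ℕ, idx = fun i =>
      if α / 2 ≤ i then 2 * (i + 1 - α / 2) else 2 * (α / 2 - i) - 1 := ⟨_, rfl⟩
  have hmem : ∀ i, i + 1 < α → idx i ∈ Finset.Ico 1 α := by
    intro i hi
    rw [Finset.mem_Ico, hidx]
    dsimp only
    split_ifs <;> omega
  have hinj : ∀ i j, i < j → j + 1 < α → idx i ≠ idx j := by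
    intro i j hij hj
    rw [hidx]
    dsimp only
    split_ifs <;> omega
  have hq0 : ∀ v, zigzag α (F v) < α := fun v => zigzag_lt (T.rank_lt v)
  refine nonempty_iso_cliquePath hk (fun v => ⟨zigzag α (F v), hq0 v⟩) ?_ ?_
    (fun i => if α / 2 ≤ i then b (idx i) else a (idx i))
    (fun i => if α / 2 ≤ i - 1 then a (idx (i - 1)) else b (idx (i - 1))) ?_ ?_ ?_ ?_ ?_
  · intro i
    rw [Nat.card_eq_fintype_card, Fintype.card_subtype, Finset.card_filter,
      ← T.card_rank (zigzagRank α i) (zigzagRank_lt i.2)]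
    refine Finset.sum_congr rfl fun v _ => if_congr ?_ rfl rfl
    rw [Fin.ext_iff]
    constructor
    · intro h
      rw [← h]
      exact (zigzagRank_zigzag (T.rank_lt v)).symm
    · intro h
      simp only [h]
      exact zigzag_zigzagRank i.2
  · intro u v huv h
    refine T.adj_of_rank_eq u v huv ?_
    have := congrArg (fun i : Fin α => zigzagRank α i) h
    simpa only [zigzagRank_zigzag (T.rank_lt _)] using this
  · intro i hi
    have h := hmem i hi
    dsimp only
    split_ifs with h1
    · rw [T.rank_b _ h, hp _ h, hidx]
      dsimp only
      unfold zigzag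
      split_ifs <;> omega
    · rw [T.rank_a _ h, hidx]
      dsimp only
      unfold zigzag
      split_ifs <;> omega
  · intro i hi
    have h := hmem i hi
    rw [Nat.add_sub_cancel]
    dsimp only
    split_ifs with h1
    · rw [T.rank_a _ h, hidx]
      dsimp only
      unfold zigzag
      split_ifs <;> omega
    · rw [T.rank_b _ h, hp _ h, hidx]
      dsimp only
      unfold zigzag
      split_ifs <;> omega
  · intro i hi
    have h := T.adj_link _ (hmem i hi)
    rw [Nat.add_sub_cancel]
    split_ifs
    · exact h.symm
    · exact h
  · intro v w hvw hne
    obtain ⟨j, hj, h⟩ := hcross v w hvw fun h => hne (Fin.ext (by simp only [h]))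
    have hj' := Finset.mem_Ico.1 hj
    -- The inverse of `idx`: the left position of the link of rank j.
    refine ⟨if j % 2 = 0 then α / 2 + j / 2 - 1 else α / 2 - (j + 1) / 2,
      by split_ifs <;> omega, ?_⟩
    rw [Nat.add_sub_cancel]
    by_cases h2 : j % 2 = 0
    · rw [if_pos h2]
      have e : idx (α / 2 + j / 2 - 1) = j := by
        rw [hidx]; dsimp only; split_ifs <;> omega
      rw [if_pos (by omega), if_pos (by omega), e]
      exact h.symm
    · rw [if_neg h2]
      have e : idx (α / 2 - (j + 1) / 2) = j := by
        rw [hidx]; dsimp only; split_ifs <;> omega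
      rw [if_neg (by omega), if_neg (by omega), e]
      exact h
  · intro i h0 hi
    have h1 := hmem i hi
    have h2 := hmem (i - 1) (by omega)
    have h3 := hinj (i - 1) i (by omega) hi
    split_ifs
    · exact fun h => hab _ h2 _ h1 h.symm
    · exact fun h => h3 (hbb _ h1 _ h2 h).symm
    · exact fun h => h3 (haa _ h1 _ h2 h).symm
    · exact hab _ h1 _ h2

end Isomorphism

/-! ### From a small spectral radius to the clique path. -/

section Minimality

variable {V : Type*} [Fintype V] {G : SimpleGraph V} {k α : ℕ}

/-- A graph with independence number `α` on `kα` vertices whose spectral radius is only slightly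
larger than `k - 1` splits into `α` cliques of order `k`. -/
theorem exists_uniform_clique_partition (hα : 1 ≤ α) (hk : 2 * α + 1 < k)
    (hG : IsConnectedOfOrderIndep (k * α) α G)
    (hle : graphSpectralRadius G ≤ k - 1 + 2 / ((k : ℝ) - 1)) :
    ∃ f : V → Fin α, (∀ u v, u ≠ v → f u = f v → G.Adj u v) ∧
      ∀ i, ∑ v, (if f v = i then 1 else 0) = k := by
  classical
  have hV : Nonempty V := hG.connected.nonempty
  have hk' : 2 * (α : ℝ) + 1 < k := by exact_mod_cast hk
  have hα' : (1 : ℝ) ≤ α := by exact_mod_cast hα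
  have hk3 : (4 : ℝ) ≤ k := by exact_mod_cast (by omega : 4 ≤ k)
  have hcardV : (#(Finset.univ : Finset V) : ℤ) = k * α := by
    rw [Finset.card_univ, hG.order_eq]; push_cast; rfl
  have hedges : (adjPairs G Finset.univ Finset.univ : ℝ) ≤
      graphSpectralRadius G * (k * α) := by
    have h1 := sum_mul_adjSum_le G (fun _ => 1)
    have h2 : ∑ v : V, (1 : ℝ) ^ 2 = k * α := by
      have := congrArg (Nat.cast : ℕ → ℝ) hG.order_eq
      simpa using this
    rw [h2] at h1
    refine le_trans (le_of_eq ?_) h1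
    simp [adjPairs, SimpleGraph.adjSum]
  -- The all-ones vector bounds the ordered edges by λ(G)·kα, and the excess 2kα/(k - 1) is below 2α
  -- + 1 as k - 1 > 2α. So C = 2α + 1 < k is an admissible slack.
  have hbound : (adjPairs G Finset.univ Finset.univ : ℝ) <
      α * (k * (k - 1)) + (2 * α + 1) := by
    have h1 : graphSpectralRadius G * (k * α) ≤ (k - 1 + 2 / ((k : ℝ) - 1)) * (k * α) :=
      mul_le_mul_of_nonneg_right hle (by positivity)
    have h2 : 2 / ((k : ℝ) - 1) * (k * α) = 2 * α + 2 * α / (k - 1) := by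
      have : (k : ℝ) - 1 ≠ 0 := by linarith
      field_simp
      ring
    have h3 : 2 * (α : ℝ) / (k - 1) < 1 := by
      rw [div_lt_one (by linarith)]; linarith
    nlinarith
  have hbound' : adjPairs G Finset.univ Finset.univ <
      (α : ℤ) * (k * (k - 1)) + (2 * α + 1) := by exact_mod_cast hbound
  obtain ⟨f, hf, hadj⟩ := exists_clique_partition G (k := k) (C := 2 * α + 1)
    (by exact_mod_cast hk) α Finset.univ (fun I _ hI => by
      rw [← hG.indepNum_eq]
      exact SimpleGraph.IsIndepSet.card_le_indepNum fun u hu v hv huv => hI u hu v hv huv)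
    (by rw [hcardV]; linarith)
  refine ⟨fun v => ⟨f v, hf v (Finset.mem_univ _)⟩, fun u v huv h =>
    hadj u (Finset.mem_univ _) v (Finset.mem_univ _) huv (congrArg Fin.val h), ?_⟩
  simp only [Fin.ext_iff]
  -- A clique of order k + 1 would give λ(G) ≥ k > k - 1 + 2/(k - 1). With kα vertices in all, no
  -- part can then be smaller than k.
  have hfib : ∀ i : Fin α, ∑ v, (if f v = i.val then 1 else 0) ≤ k := by
    intro i
    rw [← Finset.card_filter]
    rcases (Finset.univ.filter fun v => f v = i.val).eq_empty_or_nonempty with h | h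
    · rw [h]; simp
    · have h1 := card_sub_one_le_spectralRadius G h fun u hu v hv huv =>
        hadj u (Finset.mem_univ _) v (Finset.mem_univ _) huv (by
          rw [(Finset.mem_filter.1 hu).2, (Finset.mem_filter.1 hv).2])
      have h2 : 2 / ((k : ℝ) - 1) < 1 := by
        rw [div_lt_one (by linarith)]; linarith
      have h3 : ((Finset.univ.filter fun v => f v = i.val).card : ℝ) < k + 1 := by linarith
      have h4 : (Finset.univ.filter fun v => f v = i.val).card < k + 1 := by exact_mod_cast h3
      omega
  have htot : ∑ i : Fin α, ∑ v, (if f v = i.val then 1 else 0) = ∑ _i : Fin α, k := by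
    rw [Finset.sum_comm]
    have h1 : ∀ v, ∑ i : Fin α, (if f v = i.val then 1 else 0) = 1 := by
      intro v
      rw [Finset.sum_eq_single_of_mem ⟨f v, hf v (Finset.mem_univ _)⟩ (Finset.mem_univ _)]
      · simp
      · intro i _ hi
        exact if_neg fun h => hi (Fin.ext h.symm)
    simp only [h1]
    simp [hG.order_eq, mul_comm]
  exact fun i => (Finset.sum_eq_sum_iff_of_le fun i _ => hfib i).1 htot i (Finset.mem_univ i)

/-- A connected graph that splits into `α` cliques of order `k` contains a ranked clique tree. -/
theorem exists_rankedCliqueTree (hG : G.Connected) (f : V → Fin α)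
    (hadj : ∀ u v, u ≠ v → f u = f v → G.Adj u v) (hk : 1 ≤ k)
    (hcard : ∀ i, ∑ v, (if f v = i then 1 else 0) = k) :
    ∃ F p a b, IsRankedCliqueTree G k α F p a b := by
  classical
  have hV : Nonempty V := hG.nonempty
  have hsurj : Function.Surjective f := by
    intro i
    by_contra! h
    have := hcard i
    simp [h] at this
    omega
  -- Contracting the cliques gives a connected graph; its zigzag enumeration supplies the ranks and
  -- the parents.
  let T : SimpleGraph (Fin α) := SimpleGraph.fromRel fun i j => ∃ u v, f u = i ∧ f v = j ∧ G.Adj u v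
  have hTadj : ∀ {i j}, T.Adj i j → ∃ u v, f u = i ∧ f v = j ∧ G.Adj u v := by
    intro i j h
    rcases ((SimpleGraph.fromRel_adj _ _ _).1 h).2 with h | ⟨u, v, hu, hv, huv⟩
    · exact h
    · exact ⟨v, u, hv, hu, huv.symm⟩
  have hTreach : ∀ u v, T.Reachable (f u) (f v) := by
    intro u v
    obtain ⟨w⟩ := hG.preconnected u v
    induction w with
    | nil => exact SimpleGraph.Reachable.refl _
    | @cons x y _ hxy _ ih =>
      refine SimpleGraph.Reachable.trans ?_ ih
      by_cases h : f x = f y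
      · rw [h]
      · exact ((SimpleGraph.fromRel_adj _ _ _).2 ⟨h, Or.inl ⟨x, y, rfl, rfl, hxy⟩⟩ :
          T.Adj (f x) (f y)).reachable
  have : Nonempty (Fin α) := hV.map f
  have hT : T.Connected := SimpleGraph.Connected.mk fun i j => by
    obtain ⟨u, rfl⟩ := hsurj i
    obtain ⟨v, rfl⟩ := hsurj j
    exact hTreach u v
  obtain ⟨e, he, hlink⟩ := exists_zigzag_order T hT
  rw [Fintype.card_fin] at he hlink
  choose rk hrk herk using he
  have hbij : Function.Bijective fun j : Fin α => e j :=
    Finite.surjective_iff_bijective.1 fun i => ⟨⟨rk i, hrk i⟩, herk i⟩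
  have hrke : ∀ j < α, rk (e j) = j := fun j hj =>
    congrArg Fin.val (hbij.1 (a₁ := ⟨rk (e j), hrk _⟩) (a₂ := ⟨j, hj⟩) (herk (e j)))
  have hex : ∀ j, ∃ (p : ℕ) (a b : V), j ∈ Finset.Ico 1 α →
      p ≤ j - 2 ∧ rk (f a) = j ∧ rk (f b) = p ∧ G.Adj a b := by
    intro j
    by_cases hj : j ∈ Finset.Ico 1 α
    · have hj' := Finset.mem_Ico.1 hj
      obtain ⟨p, hp, hadj⟩ := hlink j hj'.1 hj'.2
      obtain ⟨u, v, hu, hv, huv⟩ := hTadj hadj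
      refine ⟨p, v, u, fun _ => ⟨hp, ?_, ?_, huv.symm⟩⟩
      · rw [hv, hrke j hj'.2]
      · rw [hu, hrke p (by omega)]
    · exact ⟨0, hV.some, hV.some, fun h => absurd h hj⟩
  choose p a b hpab using hex
  refine ⟨fun v => rk (f v), p, a, b, fun v => hrk _, fun r hr => ?_, fun u v huv h => ?_,
    fun j hj => (hpab j hj).2.1, fun j hj => (hpab j hj).2.2.1, fun j hj => (hpab j hj).1,
    fun j hj => (hpab j hj).2.2.2⟩
  · rw [← hcard (e r)]
    refine Finset.sum_congr rfl fun v _ => if_congr ?_ rfl rfl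
    constructor
    · rintro rfl
      exact (herk _).symm
    · intro h
      rw [h, hrke r hr]
  · refine hadj u v huv ?_
    rw [← herk (f u), ← herk (f v)]
    exact congrArg e h

theorem nonempty_iso_of_spectralRadius_le (hα : 1 ≤ α) (hk : 2 * α + 1 < k)
    (hG : IsConnectedOfOrderIndep (k * α) α G)
    (hle : graphSpectralRadius G ≤ graphSpectralRadius (cliquePath k α)) :
    Nonempty (G ≃g cliquePath k α) := by
  obtain ⟨f, hadj, hcard⟩ := exists_uniform_clique_partition hα hk hG
    (hle.trans (cliquePath_spectralRadius_le hα (by omega)))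
  obtain ⟨F, p, a, b, T⟩ := exists_rankedCliqueTree hG.connected f hadj (by omega) hcard
  obtain ⟨s, hs, hsymm, heig⟩ := exists_pathEigenvector hα (by omega : 2 ≤ k) rfl
  obtain ⟨m, rfl⟩ : ∃ m, α = m + 1 := ⟨α - 1, by omega⟩
  have hL : 1 < graphSpectralRadius (cliquePath k (m + 1)) + 1 := by
    have h1 := le_cliquePath_spectralRadius hα (by omega : 1 ≤ k)
    have h2 : (2 : ℝ) ≤ k := by exact_mod_cast (by omega : 2 ≤ k)
    linarith
  obtain ⟨z, hz, hanti, hstrict, hsum⟩ := exists_zigzag_eigenvector hL hs hsymm heig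
  obtain ⟨h1, h2, h3, h4⟩ := T.spectralRadius_comparison hα (by omega) hL hz hanti hstrict hsum
    (by linarith)
  exact T.nonempty_iso (by omega) h1 h2 h3 h4

end Minimality

theorem theorem1p4 (n k α : ℕ) (hα : 1 ≤ α) (hn : n = k * α)
    (hk : (17 * (α : ℝ) + 15) / 8 < (k : ℝ)) :
    IsConnectedOfOrderIndep n α (cliquePath k α) ∧
      ∀ {V : Type*} [Fintype V] (G : SimpleGraph V), IsConnectedOfOrderIndep n α G →
        graphSpectralRadius (cliquePath k α) ≤ graphSpectralRadius G ∧
          (graphSpectralRadius G = graphSpectralRadius (cliquePath k α) ↔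
            Nonempty (G ≃g cliquePath k α)) := by
  subst hn
  -- The argument only needs 2α + 1 < k, and (17α + 15)/8 exceeds 2α + 1.
  have hk' : 2 * α + 1 < k := by
    have hα' : (1 : ℝ) ≤ α := by exact_mod_cast hα
    have : 2 * (α : ℝ) + 1 < k := by linarith
    exact_mod_cast this
  refine ⟨cliquePath_isConnectedOfOrderIndep hα (by omega), fun {V} _ G hG => ⟨?_, ?_, ?_⟩⟩
  · by_contra! h
    obtain ⟨e⟩ := nonempty_iso_of_spectralRadius_le hα hk' hG h.le
    exact h.ne (spectralRadius_eq_of_iso G e)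
  · exact fun h => nonempty_iso_of_spectralRadius_le hα hk' hG h.le
  · rintro ⟨e⟩
    exact spectralRadius_eq_of_iso G e
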